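/- Let $K$ be a field of characteristic $0$ that contains a square root of $-1$ and satisfies (A) for every finite extension $L$ of $K$ and every natural number $n>0$ the index $[L^*:(L^*)^n]$ is finite and, if $\operatorname{char}(K)=p>0$ and $f\colon L\to L$ is given by $f(x)=x^p-x$, then the index $[L^+:f[L]]$ of additive groups is also finite (this second clause is vacuous here). Call a valuation $v$ on $K$, with valuation ring $\mathcal{O}_v$, definable if $\mathcal{O}_v$ is a definable subset of the field $K$, i.e. defined by a first-order formula in the language of rings with parameters from $K$. Then either there is a non-trivial definable valuation on $K$, or every non-trivial valuation $v$ on $K$, with residue field $\overline{K}_v$, has the following two properties: 1. if $\operatorname{char}(\overline{K}_v)>0$, then for every $n>0$ every element of $\overline{K}_v$ is an $n$-th power in $\overline{K}_v$; 2. if $\operatorname{char}(\overline{K}_v)=0$, then there is a prime number $p$ such that for every prime $n\neq p$ every element of $\overline{K}_v$ is an $n$-th power in $\overline{K}_v$. -/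

import Mathlib

universe u w

/-- The subgroup `{x ^ p - x | x ∈ L}` of the additive group of a field `L` of
characteristic `p > 0`. -/
def artinSchreierSubgroup (L : Type u) [Field L] (p : ℕ) [Fact p.Prime] [CharP L p] :
    AddSubgroup L :=
  ((frobenius L p).toAddMonoidHom - AddMonoidHom.id L).range

/-- Assumption (A): for every finite extension `L` of `K`, every index `[Lˣ : (Lˣ)ⁿ]`, `n > 0`,
is finite and, in characteristic `p > 0`, the additive subgroup `{x ^ p - x | x ∈ L}` has finite
index in `L`.  (Every finite extension of `K` has an isomorphic copy in the universe of `K`.) -/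
def AssumptionA (K : Type u) [Field K] : Prop :=
  ∀ (L : Type u) [Field L] [Algebra K L] [FiniteDimensional K L],
    (∀ n : ℕ, 0 < n → (powMonoidHom n : Lˣ →* Lˣ).range.FiniteIndex) ∧
    (∀ (p : ℕ) [Fact p.Prime] [CharP L p], (artinSchreierSubgroup L p).FiniteIndex)

/-- A valuation on a field `K` is definable if its valuation ring is a definable subset of the
pure field `K`, that is, definable by a formula of the language of rings with parameters
from `K`. -/
def Valuation.IsDefinable {K : Type u} [Field K] {Γ₀ : Type w}
    [LinearOrderedCommGroupWithZero Γ₀] (v : Valuation K Γ₀) : Prop :=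
  letI := FirstOrder.Ring.compatibleRingOfRing K
  (Set.univ : Set K).Definable₁ FirstOrder.Language.ring {x : K | v x ≤ 1}

/-- The residue field of a valuation on a field: its valuation ring modulo the maximal ideal. -/
abbrev Valuation.residue {K : Type u} [Field K] {Γ₀ : Type w}
    [LinearOrderedCommGroupWithZero Γ₀] (v : Valuation K Γ₀) : Type u :=
  IsLocalRing.ResidueField v.valuationSubring

/-! The engine is a dichotomy for a definable proper subgroup `T` of `Kˣ` that contains -1 and all
`n`-th powers and satisfies 1 + 𝔪 ⊆ `T` for some non-trivial valuation ring. Take a minimal such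
ring `O`. If `T` contains the units of `O`, a definable coarsening of `O` can be written down from
`T` alone (`hasDefinableValuation_of_units_subset`).

Otherwise pick a unit `a` of `O` outside `T`. From `a` and `T` grow definable sets E_0 ⊆ E_1 ⊆ ...
of "bounded" elements, whose polars serve as neighbourhoods of zero. Their union is a valuation
ring, and minimality makes it `O`. If the chain stops, `O` is definable. If not, the integers lie in
a single E_r: otherwise the neighbourhoods are archimedean, and walking from 1 to `a` or to `-a` in
small steps that avoid zero would put `a` into `T` (`false_of_natCast_unbounded`). Bounded integers
yield a finer ring `u` with 1 + f`u` ⊆ `T` (`exists_finer_of_int_bounded`). Were `n` a unit of `u`,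
Newton approximation would give 1 + 𝔪_u ⊆ `T`, against minimality; so `n` lies in 𝔪_u.

This is applied to T_q, the group generated by `q`-th powers and principal units, which is proper
when the residue field lacks a `q`-th root. In residue characteristic p ≠ q, the ring `u` would have
both p and q in its maximal ideal, so a definable valuation exists; p-th roots come from finiteness
of the index of the p-th powers (`surjective_pow_char`). In residue characteristic 0, two bad primes
p, q are treated by T_p ∩ T_q: the resulting `u` has, say, p in its maximal ideal, hence is
compatible with T_q, which is the previous case. -/

/-! ### Closure properties of definable sets in the field language. -/

section Definability

open FirstOrder FirstOrder.Language

variable {K : Type u} [Field K] {α : Type}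

/-- The set `E` is definable with parameters in the pure field `K`. -/
def FieldDefinable (E : Set K) : Prop :=
  letI := FirstOrder.Ring.compatibleRingOfRing K
  (Set.univ : Set K).Definable₁ Language.ring E

/-- The predicate `P` on tuples is definable with parameters in the pure field `K`. -/
def DefinablePred (P : (α → K) → Prop) : Prop :=
  letI := FirstOrder.Ring.compatibleRingOfRing K
  (Set.univ : Set K).Definable Language.ring {v : α → K | P v}

/-- The function `f` on tuples is definable with parameters in the pure field `K`. -/
def DefinableOp (f : (α → K) → K) : Prop :=
  letI := FirstOrder.Ring.compatibleRingOfRing K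
  (Set.univ : Set K).DefinableFun Language.ring f

namespace DefinableOp

theorem var (i : α) : DefinableOp (fun v : α → K => v i) := by
  let _ := FirstOrder.Ring.compatibleRingOfRing K
  exact Set.DefinableFun.proj _

theorem const (c : K) : DefinableOp (fun _ : α → K => c) := by
  let _ := FirstOrder.Ring.compatibleRingOfRing K
  exact Language.definableFun_const _ _ (Set.mem_univ c)

theorem binary {f g : (α → K) → K} (hf : DefinableOp f) (hg : DefinableOp g) {o : (Fin 2 → K) → K}
    (ho : DefinableOp o) : DefinableOp (fun v => o ![f v, g v]) := by
  let _ := FirstOrder.Ring.compatibleRingOfRing K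
  refine Set.DefinableFun.comp (f := o) (g := fun v => ![f v, g v]) ?_ ho
  intro i
  fin_cases i
  · exact hf
  · exact hg

theorem add {f g : (α → K) → K} (hf : DefinableOp f) (hg : DefinableOp g) :
    DefinableOp (fun v => f v + g v) := by
  have ho : DefinableOp (fun v : Fin 2 → K => v 0 + v 1) := by
    let _ := FirstOrder.Ring.compatibleRingOfRing K
    have := ((Term.var 0 + Term.var 1 : Language.ring.Term (Fin 2)).definableFun_realize
      (M := K)).mono (Set.empty_subset Set.univ)
    simpa only [DefinableOp, Ring.realize_add, Ring.realize_mul, Term.realize_var] using this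
  simpa using binary hf hg ho

theorem mul {f g : (α → K) → K} (hf : DefinableOp f) (hg : DefinableOp g) :
    DefinableOp (fun v => f v * g v) := by
  have ho : DefinableOp (fun v : Fin 2 → K => v 0 * v 1) := by
    let _ := FirstOrder.Ring.compatibleRingOfRing K
    have := ((Term.var 0 * Term.var 1 : Language.ring.Term (Fin 2)).definableFun_realize
      (M := K)).mono (Set.empty_subset Set.univ)
    simpa only [DefinableOp, Ring.realize_add, Ring.realize_mul, Term.realize_var] using this
  simpa using binary hf hg ho

theorem pow {f : (α → K) → K} (hf : DefinableOp f) (n : ℕ) :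
    DefinableOp (fun v => f v ^ n) := by
  induction n with
  | zero => simpa using const 1
  | succ n ih => simpa only [pow_succ] using ih.mul hf

theorem eq {f g : (α → K) → K} (hf : DefinableOp f) (hg : DefinableOp g) :
    DefinablePred (fun v => f v = g v) := by
  let _ := FirstOrder.Ring.compatibleRingOfRing K
  exact Set.DefinableFun.ofPred_eq hf hg

theorem mem {f : (α → K) → K} (hf : DefinableOp f) {E : Set K} (hE : FieldDefinable E) :
    DefinablePred (fun v => f v ∈ E) := by
  let _ := FirstOrder.Ring.compatibleRingOfRing K
  exact Set.Definable.preimage_map (F := fun v (_ : Fin 1) => f v) (fun _ => hf) hE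

end DefinableOp

namespace DefinablePred

variable {P Q : (α → K) → Prop}

theorem and (hP : DefinablePred P) (hQ : DefinablePred Q) : DefinablePred (fun v => P v ∧ Q v) := by
  let _ := FirstOrder.Ring.compatibleRingOfRing K
  exact Set.Definable.inter hP hQ

theorem or (hP : DefinablePred P) (hQ : DefinablePred Q) : DefinablePred (fun v => P v ∨ Q v) := by
  let _ := FirstOrder.Ring.compatibleRingOfRing K
  exact Set.Definable.union hP hQ

theorem not (hP : DefinablePred P) : DefinablePred (fun v => ¬ P v) := by
  let _ := FirstOrder.Ring.compatibleRingOfRing K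
  exact Set.Definable.compl hP

theorem imp (hP : DefinablePred P) (hQ : DefinablePred Q) : DefinablePred (fun v => P v → Q v) := by
  simpa only [imp_iff_not_or] using hP.not.or hQ

theorem ex {R : (α → K) → K → Prop}
    (hR : DefinablePred (fun w : α ⊕ Unit → K => R (fun i => w (.inl i)) (w (.inr ())))) :
    DefinablePred (fun v => ∃ x, R v x) := by
  let _ := FirstOrder.Ring.compatibleRingOfRing K
  have := Set.Definable.exists_of_finite hR
  unfold DefinablePred
  convert this using 1
  ext v
  exact ⟨fun ⟨x, hx⟩ => ⟨fun _ => x, hx⟩, fun ⟨u, hu⟩ => ⟨u (), hu⟩⟩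

theorem all {R : (α → K) → K → Prop}
    (hR : DefinablePred (fun w : α ⊕ Unit → K => R (fun i => w (.inl i)) (w (.inr ())))) :
    DefinablePred (fun v => ∀ x, R v x) := by
  have := (ex (R := fun v x => ¬ R v x) hR.not).not
  simpa only [not_exists, not_not] using this

theorem fieldDefinable {P : K → Prop} (h : DefinablePred (fun v : Fin 1 → K => P (v 0))) :
    FieldDefinable {x | P x} := h

end DefinablePred

theorem FieldDefinable.empty : FieldDefinable (∅ : Set K) := by
  let _ := FirstOrder.Ring.compatibleRingOfRing K
  exact Set.definable_empty

theorem FieldDefinable.union {E F : Set K} (hE : FieldDefinable E) (hF : FieldDefinable F) :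
    FieldDefinable (E ∪ F) :=
  (((DefinableOp.var 0).mem hE).or ((DefinableOp.var 0).mem hF)).fieldDefinable

theorem FieldDefinable.biUnion {ι : Type*} {s : Set ι} (hs : s.Finite) {E : ι → Set K}
    (hE : ∀ i ∈ s, FieldDefinable (E i)) : FieldDefinable (⋃ i ∈ s, E i) := by
  induction s, hs using Set.Finite.induction_on with
  | empty => simpa using FieldDefinable.empty
  | insert _ _ ih =>
    rw [Set.biUnion_insert]
    exact (hE _ (Set.mem_insert _ _)).union (ih fun i hi => hE i (Set.mem_insert_of_mem _ hi))

theorem FieldDefinable.of_finite {E : Set K} (hE : E.Finite) : FieldDefinable E := by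
  have := FieldDefinable.biUnion hE (E := fun c => ({c} : Set K)) fun c _ =>
    ((DefinableOp.var 0).eq (DefinableOp.const c)).fieldDefinable
  simpa using this

end Definability

/-! ### Subgroups containing the units of a valuation ring. -/

section DefinableValuation

variable (K : Type u) [Field K]

/-- `K` has a proper valuation subring that is definable in the pure field `K`. -/
def HasDefinableValuation : Prop :=
  ∃ A : ValuationSubring K, A ≠ ⊤ ∧ FieldDefinable (A : Set K)

variable {K}

theorem HasDefinableValuation.exists_valuation (h : HasDefinableValuation K) :
    ∃ (Γ₀ : Type u) (_ : LinearOrderedCommGroupWithZero Γ₀) (v : Valuation K Γ₀),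
      Function.Surjective v ∧ v.IsNontrivial ∧ v.IsDefinable := by
  obtain ⟨A, hA, hd⟩ := h
  refine ⟨A.ValueGroup, inferInstance, A.valuation, A.valuation_surjective, ?_, ?_⟩
  · by_contra hn
    exact hA (A.eq_top_iff.mpr hn)
  · have : {x : K | A.valuation x ≤ 1} = (A : Set K) := by
      ext x
      exact A.valuation_le_one_iff x
    unfold Valuation.IsDefinable
    rw [this]
    exact hd

/-- The image in `K` of a subgroup of the multiplicative group of `K`. -/
def Subgroup.fieldSet (T : Subgroup Kˣ) : Set K := {x | ∃ t ∈ T, (t : K) = x}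

namespace Subgroup

variable {T : Subgroup Kˣ} {x y : K}

theorem fieldSet_ne_zero (hx : x ∈ T.fieldSet) : x ≠ 0 := by
  obtain ⟨t, -, rfl⟩ := hx
  exact t.ne_zero

theorem zero_notMem_fieldSet : (0 : K) ∉ T.fieldSet := fun h => fieldSet_ne_zero h rfl

theorem one_mem_fieldSet : (1 : K) ∈ T.fieldSet := ⟨1, T.one_mem, rfl⟩

theorem mul_mem_fieldSet (hx : x ∈ T.fieldSet) (hy : y ∈ T.fieldSet) : x * y ∈ T.fieldSet := by
  obtain ⟨t, ht, rfl⟩ := hx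
  obtain ⟨s, hs, rfl⟩ := hy
  exact ⟨t * s, T.mul_mem ht hs, rfl⟩

theorem inv_mem_fieldSet (hx : x ∈ T.fieldSet) : x⁻¹ ∈ T.fieldSet := by
  obtain ⟨t, ht, rfl⟩ := hx
  exact ⟨t⁻¹, T.inv_mem ht, by simp⟩

theorem mul_mem_fieldSet_iff (hx : x ∈ T.fieldSet) : x * y ∈ T.fieldSet ↔ y ∈ T.fieldSet := by
  refine ⟨fun h => ?_, mul_mem_fieldSet hx⟩
  have := mul_mem_fieldSet (inv_mem_fieldSet hx) h
  rwa [inv_mul_cancel_left₀ (fieldSet_ne_zero hx)] at this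

theorem mul_mem_fieldSet_iff' (hy : y ∈ T.fieldSet) : x * y ∈ T.fieldSet ↔ x ∈ T.fieldSet := by
  rw [mul_comm, mul_mem_fieldSet_iff hy]

theorem inv_mem_fieldSet_iff : x⁻¹ ∈ T.fieldSet ↔ x ∈ T.fieldSet :=
  ⟨fun h => by simpa using inv_mem_fieldSet h, inv_mem_fieldSet⟩

theorem coe_mem_fieldSet {t : Kˣ} : (t : K) ∈ T.fieldSet ↔ t ∈ T :=
  ⟨fun ⟨_, hs, h⟩ => Units.ext h ▸ hs, fun h => ⟨t, h, rfl⟩⟩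

end Subgroup

namespace ValuationSubring

variable {O : ValuationSubring K} {x y : K}

theorem mem_of_mem_nonunits (hx : x ∈ O.nonunits) : x ∈ O := O.nonunits_subset hx

theorem inv_mem_nonunits_of_notMem (hx : x ∉ O) : x⁻¹ ∈ O.nonunits :=
  O.inv_mem_nonunits_iff.mpr (.inr hx)

theorem mul_mem_nonunits (hx : x ∈ O) (hy : y ∈ O.nonunits) : x * y ∈ O.nonunits := by
  rw [mem_nonunits_iff] at hy ⊢
  rw [map_mul]
  exact (mul_le_of_le_one_left' ((O.valuation_le_one_iff x).mpr hx)).trans_lt hy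

theorem inv_mem_of_notMem_nonunits (hx : x ∉ O.nonunits) : x⁻¹ ∈ O := by
  rw [mem_nonunits_iff_or] at hx
  push Not at hx
  exact hx.2

theorem one_notMem_nonunits : (1 : K) ∉ O.nonunits := by
  simp [mem_nonunits_iff]

theorem inv_notMem_nonunits (hx : x ∈ O) (h0 : x ≠ 0) : x⁻¹ ∉ O.nonunits := fun h => by
  have := mul_mem_nonunits hx h
  rw [mul_inv_cancel₀ h0] at this
  exact one_notMem_nonunits this

theorem one_add_notMem_nonunits (hx : x ∈ O.nonunits) : 1 + x ∉ O.nonunits := fun h => by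
  have := O.nonunits.sub_mem h hx
  rw [add_sub_cancel_right] at this
  exact one_notMem_nonunits this

/-- An overset of a valuation subring that is closed under multiplication is closed under
addition. -/
theorem add_mem_of_mul_closed {R : Set K} (hO : ∀ x ∈ O, x ∈ R)
    (hmul : ∀ x ∈ R, ∀ y ∈ R, x * y ∈ R) {x y : K} (hx : x ∈ R) (hy : y ∈ R) : x + y ∈ R := by
  rcases eq_or_ne x 0 with rfl | hx0
  · simpa using hy
  rcases eq_or_ne y 0 with rfl | hy0
  · simpa using hx
  rcases O.mem_or_inv_mem (x / y) with h | h
  · have : x + y = (x / y + 1) * y := by field_simp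
    rw [this]
    exact hmul _ (hO _ (O.add_mem _ _ h O.one_mem)) _ hy
  · have : x + y = (1 + (x / y)⁻¹) * x := by field_simp
    rw [this]
    exact hmul _ (hO _ (O.add_mem _ _ O.one_mem h)) _ hx

/-- A set containing a valuation subring and closed under multiplication is a valuation subring. -/
def ofMulClosed (O : ValuationSubring K) (R : Set K) (hO : ∀ x ∈ O, x ∈ R)
    (hmul : ∀ x ∈ R, ∀ y ∈ R, x * y ∈ R) : ValuationSubring K where
  carrier := R
  mul_mem' := fun hx hy => hmul _ hx _ hy
  one_mem' := hO _ O.one_mem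
  add_mem' := fun hx hy => add_mem_of_mul_closed hO hmul hx hy
  zero_mem' := hO _ O.zero_mem
  neg_mem' := fun {x} hx => by
    rw [← neg_one_mul]
    exact hmul _ (hO _ (O.neg_mem _ O.one_mem)) _ hx
  mem_or_inv_mem' := fun x => (O.mem_or_inv_mem x).imp (hO _) (hO _)

end ValuationSubring

open Subgroup ValuationSubring in
/-- A definable proper subgroup containing all units of a valuation ring gives rise to a definable
valuation. -/
theorem hasDefinableValuation_of_units_subset {O : ValuationSubring K} {T : Subgroup Kˣ}
    (hT : FieldDefinable T.fieldSet) (htop : T ≠ ⊤)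
    (hunits : ∀ x, x ∈ O → x ∉ O.nonunits → x ∈ T.fieldSet) : HasDefinableValuation K := by
  set S := T.fieldSet with hS
  -- This makes 𝔪 ∖ S definable from S. For d outside `O`, 1 + d = d (1 + d⁻¹) and the second factor
  -- is a unit, so 1 + d stays outside S with d.
  have hD : ∀ d, d ∉ S → (1 + d ∈ S ↔ d ∈ O.nonunits) := by
    intro d hd
    refine ⟨fun h => ?_, fun h => hunits _ (O.add_mem _ _ O.one_mem (mem_of_mem_nonunits h))
      (one_add_notMem_nonunits h)⟩
    by_contra hdn
    have hdO : d ∉ O := fun h' => hd (hunits d h' hdn)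
    have hd0 : d ≠ 0 := fun h0 => hdO (h0 ▸ O.zero_mem)
    have hinv := inv_mem_nonunits_of_notMem hdO
    have h1 : 1 + d⁻¹ ∈ S := hunits _ (O.add_mem _ _ O.one_mem (mem_of_mem_nonunits hinv))
      (one_add_notMem_nonunits hinv)
    have h2 : 1 + d = d * (1 + d⁻¹) := by field_simp; ring
    rw [h2, hS, mul_mem_fieldSet_iff' h1] at h
    exact hd h
  obtain ⟨b, hb0, hbS, hbO⟩ : ∃ b, b ≠ 0 ∧ b ∉ S ∧ b ∈ O.nonunits := by
    obtain ⟨t, ht⟩ : ∃ t, t ∉ T := by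
      by_contra! h
      exact htop (Subgroup.eq_top_iff' T |>.mpr h)
    have htS : (t : K) ∉ S := fun h => ht (coe_mem_fieldSet.mp h)
    by_cases htn : (t : K) ∈ O.nonunits
    · exact ⟨t, t.ne_zero, htS, htn⟩
    · refine ⟨(t : K)⁻¹, inv_ne_zero t.ne_zero, fun h => htS (inv_mem_fieldSet_iff.mp h), ?_⟩
      exact inv_mem_nonunits_of_notMem fun h => htS (hunits _ h htn)
  -- By `hD`, R consists of 𝔪 ∖ S together with the x ∈ S that multiply 𝔪 ∖ S into 𝔪. It contains
  -- `O` but misses b⁻¹.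
  let R : Set K := {x | (x ∉ S ∧ 1 + x ∈ S) ∨ (x ∈ S ∧ ∀ d, d ∉ S → 1 + d ∈ S → 1 + x * d ∈ S)}
  have hR : ∀ x, x ∈ R ↔
      (x ∉ S ∧ x ∈ O.nonunits) ∨ (x ∈ S ∧ ∀ d, d ∉ S → d ∈ O.nonunits → x * d ∈ O.nonunits) := by
    intro x
    refine or_congr (and_congr_right fun h => hD x h) (and_congr_right fun h =>
      forall_congr' fun d => forall_congr' fun hd => ?_)
    rw [hD d hd, hD (x * d)]
    rwa [hS, mul_mem_fieldSet_iff h]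
  have hOR : ∀ x ∈ O, x ∈ R := by
    intro x hx
    rw [hR]
    by_cases hxS : x ∈ S
    · exact .inr ⟨hxS, fun d _ hd => mul_mem_nonunits hx hd⟩
    · refine .inl ⟨hxS, ?_⟩
      by_contra hn
      exact hxS (hunits x hx hn)
  have hmix : ∀ x ∈ R, ∀ y ∈ R, x ∉ S → x * y ∈ R := by
    intro x hx y hy hxS
    have hxm : x ∈ O.nonunits := by
      rcases (hR x).mp hx with h | h
      · exact h.2
      · exact absurd h.1 hxS
    apply hOR
    rcases (hR y).mp hy with h | h
    · exact O.mul_mem _ _ (mem_of_mem_nonunits hxm) (mem_of_mem_nonunits h.2)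
    · rw [mul_comm]
      exact mem_of_mem_nonunits (h.2 x hxS hxm)
  have hmul : ∀ x ∈ R, ∀ y ∈ R, x * y ∈ R := by
    intro x hx y hy
    by_cases hxS : x ∈ S
    swap
    · exact hmix x hx y hy hxS
    by_cases hyS : y ∈ S
    swap
    · rw [mul_comm]
      exact hmix y hy x hx hyS
    have hx' := ((hR x).mp hx).resolve_left fun h => h.1 hxS
    have hy' := ((hR y).mp hy).resolve_left fun h => h.1 hyS
    refine (hR _).mpr (.inr ⟨mul_mem_fieldSet hxS hyS, fun d hd hdm => ?_⟩)
    rw [mul_assoc]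
    refine hx'.2 _ ?_ (hy'.2 d hd hdm)
    rwa [hS, mul_mem_fieldSet_iff hyS]
  refine ⟨ofMulClosed O R hOR hmul, fun h => ?_, ?_⟩
  · have hb : b⁻¹ ∈ R := by
      have : b⁻¹ ∈ ofMulClosed O R hOR hmul := h ▸ mem_top _
      exact this
    have hbS' : b⁻¹ ∉ S := fun h => hbS (inv_mem_fieldSet_iff.mp h)
    rcases (hR _).mp hb with h | h
    · exact inv_notMem_nonunits (mem_of_mem_nonunits hbO) hb0 h.2
    · exact hbS' h.1
  · refine DefinablePred.fieldDefinable (P := fun x => (x ∉ S ∧ 1 + x ∈ S) ∨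
      (x ∈ S ∧ ∀ d, d ∉ S → 1 + d ∈ S → 1 + x * d ∈ S)) ?_
    open DefinableOp in
    refine (((var 0).mem hT).not.and (((const 1).add (var 0)).mem hT)).or
      (((var 0).mem hT).and (DefinablePred.all ?_))
    exact ((var (Sum.inr ())).mem hT).not.imp
      ((((const 1).add (var (Sum.inr ()))).mem hT).imp
        (((const 1).add ((var (Sum.inl 0)).mul (var (Sum.inr ())))).mem hT))

end DefinableValuation

/-! ### The chain E_i of bounded sets and the valuation ring it generates. -/

section BoundedChain

open Subgroup

variable {K : Type u} [Field K] (T : Subgroup Kˣ)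

/-- The set of `y` such that `1 + y e ∈ T` for all `e ∈ E`. -/
def unitPolar (E : Set K) : Set K := {y | ∀ e ∈ E, 1 + y * e ∈ T.fieldSet}

/-- The sums and products of two elements of `E`, the quotients of elements of `E` by elements of
`E` outside the polar, and the elements that are recognized as bounded by such elements. -/
def boundedNext (E : Set K) : Set K :=
  {x | ∃ b, b ∈ E ∧ ∃ c, c ∈ E ∧ (x = b + c ∨ x = b * c ∨ (c ∉ unitPolar T E ∧ x * c = b) ∨
    (c ∉ unitPolar T E ∧ ∀ t, t ∈ T.fieldSet → x + c ≠ x * t))}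

/-- The increasing chain of definable sets generated by `a`. -/
def boundedChain (a : K) : ℕ → Set K
  | 0 => {0, 1, -1, a, -a, a⁻¹, -a⁻¹}
  | n + 1 => boundedNext T (boundedChain a n)

open DefinableOp in
theorem fieldDefinable_unitPolar {E : Set K} (hT : FieldDefinable T.fieldSet)
    (hE : FieldDefinable E) : FieldDefinable (unitPolar T E) := by
  refine DefinablePred.fieldDefinable (P := fun y => ∀ e, e ∈ E → 1 + y * e ∈ T.fieldSet) ?_
  refine DefinablePred.all ?_
  exact ((var (Sum.inr ())).mem hE).imp
    (((const 1).add ((var (Sum.inl 0)).mul (var (Sum.inr ())))).mem hT)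

open DefinableOp in
theorem fieldDefinable_boundedNext {E : Set K} (hT : FieldDefinable T.fieldSet)
    (hE : FieldDefinable E) : FieldDefinable (boundedNext T E) := by
  have hN := fieldDefinable_unitPolar T hT hE
  refine DefinablePred.fieldDefinable (P := fun x => ∃ b, b ∈ E ∧ ∃ c, c ∈ E ∧
    (x = b + c ∨ x = b * c ∨ (c ∉ unitPolar T E ∧ x * c = b) ∨
    (c ∉ unitPolar T E ∧ ∀ t, t ∈ T.fieldSet → x + c ≠ x * t))) ?_
  refine DefinablePred.ex (((var (Sum.inr ())).mem hE).and (DefinablePred.ex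
    (((var (Sum.inr ())).mem hE).and ?_)))
  have x := var (K := K) (Sum.inl (Sum.inl (0 : Fin 1)) : (Fin 1 ⊕ Unit) ⊕ Unit)
  have b := var (K := K) (Sum.inl (Sum.inr ()) : (Fin 1 ⊕ Unit) ⊕ Unit)
  have c := var (K := K) (Sum.inr () : (Fin 1 ⊕ Unit) ⊕ Unit)
  refine (x.eq (b.add c)).or ((x.eq (b.mul c)).or
    (((c.mem hN).not.and ((x.mul c).eq b)).or ((c.mem hN).not.and (DefinablePred.all ?_))))
  have x' := var (K := K) (Sum.inl (Sum.inl (Sum.inl (0 : Fin 1))) : ((Fin 1 ⊕ Unit) ⊕ Unit) ⊕ Unit)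
  have c' := var (K := K) (Sum.inl (Sum.inr ()) : ((Fin 1 ⊕ Unit) ⊕ Unit) ⊕ Unit)
  have t' := var (K := K) (Sum.inr () : ((Fin 1 ⊕ Unit) ⊕ Unit) ⊕ Unit)
  exact (t'.mem hT).imp ((x'.add c').eq (x'.mul t')).not

theorem fieldDefinable_boundedChain (hT : FieldDefinable T.fieldSet) (a : K) (n : ℕ) :
    FieldDefinable (boundedChain T a n) := by
  induction n with
  | zero => exact .of_finite (by simp [boundedChain])
  | succ n ih => exact fieldDefinable_boundedNext T hT ih

namespace boundedChain

variable {T} {a : K} {i j : ℕ} {x y z : K}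

theorem zero_mem : (0 : K) ∈ boundedChain T a i := by
  induction i with
  | zero => simp [boundedChain]
  | succ n ih => exact ⟨0, ih, 0, ih, .inl (by simp)⟩

theorem le_succ : boundedChain T a i ⊆ boundedChain T a (i + 1) :=
  fun x hx => ⟨x, hx, 0, zero_mem, .inl (by simp)⟩

theorem mono : Monotone (boundedChain T a) := monotone_nat_of_le_succ fun _ => le_succ

theorem start_mem (h : x ∈ boundedChain T a 0) : x ∈ boundedChain T a i := mono (Nat.zero_le i) h

theorem one_mem : (1 : K) ∈ boundedChain T a i := start_mem (by simp [boundedChain])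

theorem neg_one_mem : (-1 : K) ∈ boundedChain T a i := start_mem (by simp [boundedChain])

theorem self_mem : a ∈ boundedChain T a i := start_mem (by simp [boundedChain])

theorem inv_self_mem : a⁻¹ ∈ boundedChain T a i := start_mem (by simp [boundedChain])

theorem add_mem (hx : x ∈ boundedChain T a i) (hy : y ∈ boundedChain T a i) :
    x + y ∈ boundedChain T a (i + 1) := ⟨x, hx, y, hy, .inl rfl⟩

theorem mul_mem (hx : x ∈ boundedChain T a i) (hy : y ∈ boundedChain T a i) :
    x * y ∈ boundedChain T a (i + 1) := ⟨x, hx, y, hy, .inr (.inl rfl)⟩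

theorem neg_mem (hx : x ∈ boundedChain T a i) : -x ∈ boundedChain T a (i + 1) := by
  rw [← neg_one_mul]
  exact mul_mem neg_one_mem hx

theorem polar_anti (h : i ≤ j) :
    unitPolar T (boundedChain T a j) ⊆ unitPolar T (boundedChain T a i) :=
  fun _ hy e he => hy e (mono h he)

/-- Membership would put 1 - x x⁻¹ = 0 into `T`. This is why E_0 contains -1, `-a` and `-a⁻¹`. -/
theorem notMem_polar_of_neg_inv (h0 : x ≠ 0) (hx : -x⁻¹ ∈ boundedChain T a i) :
    x ∉ unitPolar T (boundedChain T a i) := fun h => by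
  have := h _ hx
  rw [mul_neg, mul_inv_cancel₀ h0, add_neg_cancel] at this
  exact zero_notMem_fieldSet this

theorem one_notMem_polar : (1 : K) ∉ unitPolar T (boundedChain T a i) :=
  notMem_polar_of_neg_inv one_ne_zero (by simpa using neg_one_mem)

theorem zero_mem_polar : (0 : K) ∈ unitPolar T (boundedChain T a i) :=
  fun e _ => by simpa using one_mem_fieldSet

theorem ne_zero_of_notMem_polar (hx : x ∉ unitPolar T (boundedChain T a i)) : x ≠ 0 :=
  fun h => hx (h ▸ zero_mem_polar)

theorem self_notMem_polar (h0 : a ≠ 0) : a ∉ unitPolar T (boundedChain T a i) :=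
  notMem_polar_of_neg_inv h0 (start_mem (by simp [boundedChain]))

theorem inv_self_notMem_polar (h0 : a ≠ 0) : a⁻¹ ∉ unitPolar T (boundedChain T a i) :=
  notMem_polar_of_neg_inv (inv_ne_zero h0) (start_mem (by simp [boundedChain]))

theorem div_mem (hx : x ∈ boundedChain T a i) (hy : y ∈ boundedChain T a i)
    (hyN : y ∉ unitPolar T (boundedChain T a i)) : x / y ∈ boundedChain T a (i + 1) :=
  ⟨x, hx, y, hy, .inr (.inr (.inl ⟨hyN, div_mul_cancel₀ x (ne_zero_of_notMem_polar hyN)⟩))⟩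

theorem inv_mem (hy : y ∈ boundedChain T a i)
    (hyN : y ∉ unitPolar T (boundedChain T a i)) : y⁻¹ ∈ boundedChain T a (i + 1) := by
  rw [← one_div]
  exact div_mem one_mem hy hyN

theorem ne_zero_of_notMem (hx : x ∉ boundedChain T a i) : x ≠ 0 := fun h => hx (h ▸ zero_mem)

/-- If `x` is not bounded, then `1 + c / x` lies in `T` for `c` bounded and bounded away from
zero. -/
theorem one_add_inv_mul_mem (hx : x ∉ boundedChain T a (i + 1)) {c : K}
    (hc : c ∈ boundedChain T a i) (hcN : c ∉ unitPolar T (boundedChain T a i)) :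
    1 + x⁻¹ * c ∈ T.fieldSet := by
  by_contra h
  have h0 := ne_zero_of_notMem hx
  refine hx ⟨0, zero_mem, c, hc, .inr (.inr (.inr ⟨hcN, fun t ht he => h ?_⟩))⟩
  have : 1 + x⁻¹ * c = t := by field_simp; exact he
  rwa [this]

variable (ha0 : a ≠ 0) (haT : a ∉ T.fieldSet)

include ha0 haT

/-- If x and x⁻¹ both escaped, 1 + x = x (1 + x⁻¹) would give x ∈ `T`, and then 1 + xa = a x (1 +
x⁻¹a⁻¹) would give a ∈ `T`. -/
theorem inv_mem_of_notMem (hx : x ∉ boundedChain T a (i + 1)) :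
    x⁻¹ ∈ boundedChain T a (i + 1) := by
  by_contra hx'
  have h0 := ne_zero_of_notMem hx
  have h1 := one_add_inv_mul_mem hx one_mem one_notMem_polar
  have h2 := one_add_inv_mul_mem hx inv_self_mem (inv_self_notMem_polar ha0)
  have h3 := one_add_inv_mul_mem hx' one_mem one_notMem_polar
  have h4 := one_add_inv_mul_mem hx' self_mem (self_notMem_polar ha0)
  rw [inv_inv] at h3 h4
  have e1 : 1 + x * 1 = x * (1 + x⁻¹ * 1) := by field_simp; ring
  rw [e1, mul_mem_fieldSet_iff' h1] at h3
  have e2 : 1 + x * a = a * (x * (1 + x⁻¹ * a⁻¹)) := by field_simp; ring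
  rw [e2, mul_mem_fieldSet_iff' (mul_mem_fieldSet h3 h2)] at h4
  exact haT h4

/-- The same two identities apply. The bound E_1 does not depend on `i`, so multiplying by a small
element resets the index; later inductions rely on this. -/
theorem polar_subset : unitPolar T (boundedChain T a i) ⊆ boundedChain T a 1 := by
  intro y hy
  by_contra hyE
  have h0 := ne_zero_of_notMem hyE
  have h1 := one_add_inv_mul_mem hyE one_mem one_notMem_polar
  have h2 := one_add_inv_mul_mem hyE inv_self_mem (inv_self_notMem_polar ha0)
  have h3 := hy 1 one_mem
  have h4 := hy a self_mem
  have e1 : 1 + y * 1 = y * (1 + y⁻¹ * 1) := by field_simp; ring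
  rw [e1, mul_mem_fieldSet_iff' h1] at h3
  have e2 : 1 + y * a = a * (y * (1 + y⁻¹ * a⁻¹)) := by field_simp; ring
  rw [e2, mul_mem_fieldSet_iff' (mul_mem_fieldSet h3 h2)] at h4
  exact haT h4

omit ha0 haT in
theorem polar_mul_mem (hy : y ∈ unitPolar T (boundedChain T a (i + 1)))
    (hx : x ∈ boundedChain T a i) : y * x ∈ unitPolar T (boundedChain T a i) := by
  intro e he
  rw [mul_assoc]
  exact hy _ (mul_mem hx he)

theorem inv_mem_polar_of_notMem (hx : x ∉ boundedChain T a (i + 2)) :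
    x⁻¹ ∈ unitPolar T (boundedChain T a (i + 1)) := by
  by_contra h
  have h1 := inv_mem_of_notMem ha0 haT fun h' => hx (mono (Nat.le_succ (i + 1)) h')
  exact hx (by simpa using inv_mem h1 h)

/-- The test element is c = a - 1, which is not small because 1 + c = a ∉ `T`. If (1 + z)⁻¹ were
unbounded, then 1 + (1 + z) c = a (1 + z (1 - a⁻¹)) would be in `T`, and so would a. -/
theorem one_add_inv_mem (hz : z ∈ unitPolar T (boundedChain T a 1)) :
    (1 + z)⁻¹ ∈ boundedChain T a 2 := by
  by_contra h
  have hc : a + -1 ∈ boundedChain T a 1 := add_mem self_mem neg_one_mem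
  have hcN : a + -1 ∉ unitPolar T (boundedChain T a 1) := fun h' => by
    have := h' 1 one_mem
    rw [mul_one, add_neg_cancel_comm_assoc] at this
    exact haT this
  have h1 := one_add_inv_mul_mem h hc hcN
  have hd : 1 + -a⁻¹ ∈ boundedChain T a 1 := add_mem one_mem (start_mem (by simp [boundedChain]))
  have h2 := hz _ hd
  have e : 1 + (1 + z)⁻¹⁻¹ * (a + -1) = a * (1 + z * (1 + -a⁻¹)) := by
    rw [inv_inv]; field_simp; ring
  rw [e, mul_mem_fieldSet_iff' h2] at h1
  exact haT h1

/-- Since 1 + (y + z) e = (1 + ye)(1 + z e (1 + ye)⁻¹), it suffices that (1 + ye)⁻¹ is bounded. -/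
theorem polar_add_mem (hy : y ∈ unitPolar T (boundedChain T a (i + 3)))
    (hz : z ∈ unitPolar T (boundedChain T a (i + 3))) :
    y + z ∈ unitPolar T (boundedChain T a i) := by
  intro e he
  have he1 : e ∈ boundedChain T a (i + 2) := mono (by omega) he
  have h1 : y * e ∈ unitPolar T (boundedChain T a 1) :=
    polar_anti (by omega) (polar_mul_mem hy he1)
  have h2 : (1 + y * e)⁻¹ ∈ boundedChain T a (i + 2) :=
    mono (by omega) (one_add_inv_mem ha0 haT h1)
  have h3 := hz _ (mul_mem he1 h2)
  have h4 : 1 + y * e ∈ T.fieldSet := hy e (mono (by omega) he)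
  have h5 := fieldSet_ne_zero h4
  have e : 1 + (y + z) * e = (1 + y * e) * (1 + z * (e * (1 + y * e)⁻¹)) := by
    field_simp; ring
  rw [e]
  exact mul_mem_fieldSet h4 h3

/-- The union of the chain is a valuation subring. -/
def union : ValuationSubring K where
  carrier := ⋃ i, boundedChain T a i
  zero_mem' := Set.mem_iUnion.mpr ⟨0, zero_mem⟩
  one_mem' := Set.mem_iUnion.mpr ⟨0, one_mem⟩
  add_mem' {x y} hx hy := by
    obtain ⟨i, hi⟩ := Set.mem_iUnion.mp hx
    obtain ⟨j, hj⟩ := Set.mem_iUnion.mp hy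
    exact Set.mem_iUnion.mpr ⟨max i j + 1, add_mem (mono (le_max_left i j) hi)
      (mono (le_max_right i j) hj)⟩
  mul_mem' {x y} hx hy := by
    obtain ⟨i, hi⟩ := Set.mem_iUnion.mp hx
    obtain ⟨j, hj⟩ := Set.mem_iUnion.mp hy
    exact Set.mem_iUnion.mpr ⟨max i j + 1, mul_mem (mono (le_max_left i j) hi)
      (mono (le_max_right i j) hj)⟩
  neg_mem' {x} hx := by
    obtain ⟨i, hi⟩ := Set.mem_iUnion.mp hx
    exact Set.mem_iUnion.mpr ⟨i + 1, neg_mem hi⟩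
  mem_or_inv_mem' x := by
    by_cases h : x ∈ boundedChain T a 1
    · exact .inl (Set.mem_iUnion.mpr ⟨1, h⟩)
    · exact .inr (Set.mem_iUnion.mpr ⟨1, inv_mem_of_notMem ha0 haT h⟩)

theorem mem_union : x ∈ union ha0 haT ↔ ∃ i, x ∈ boundedChain T a i := Set.mem_iUnion

/-- A nonunit outside the polar would have a bounded inverse. Testing against e = 1 gives 1 + 𝔪 ⊆
`T`. -/
theorem union_nonunits_subset (hx : x ∈ (union ha0 haT).nonunits) :
    x ∈ unitPolar T (boundedChain T a i) := by
  by_contra h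
  obtain ⟨j, hj⟩ := (mem_union ha0 haT).mp (ValuationSubring.mem_of_mem_nonunits hx)
  have h1 : x⁻¹ ∈ boundedChain T a (max i j + 1) :=
    inv_mem (mono (le_max_right i j) hj) fun h' => h (polar_anti (le_max_left i j) h')
  rcases (ValuationSubring.mem_nonunits_iff_or _).mp hx with h2 | h2
  · exact h (h2 ▸ zero_mem_polar)
  · exact h2 ((mem_union ha0 haT).mpr ⟨_, h1⟩)

omit ha0 haT in
/-- The chain stays inside every valuation subring `O` with `1 + 𝔪 ⊆ T` that has `a` as a unit. -/
theorem subset_of_compatible {O : ValuationSubring K}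
    (hO : ∀ x ∈ O.nonunits, 1 + x ∈ T.fieldSet) (ha : a ∈ O) (ha' : a⁻¹ ∈ O) :
    boundedChain T a i ⊆ O := by
  induction i with
  | zero =>
    intro x hx
    simp only [boundedChain, Set.mem_insert_iff, Set.mem_singleton_iff] at hx
    rcases hx with rfl | rfl | rfl | rfl | rfl | rfl | rfl
    exacts [O.zero_mem, O.one_mem, O.neg_mem _ O.one_mem, ha, O.neg_mem _ ha, ha', O.neg_mem _ ha']
  | succ n ih =>
    have hN : ∀ c ∉ unitPolar T (boundedChain T a n), c⁻¹ ∈ O := by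
      intro c hc
      refine ValuationSubring.inv_mem_of_notMem_nonunits fun hcm => hc fun e he => hO _ ?_
      rw [mul_comm]
      exact ValuationSubring.mul_mem_nonunits (ih he) hcm
    rintro x ⟨b, hb, c, hc, rfl | rfl | ⟨hcN, rfl⟩ | ⟨hcN, h⟩⟩
    · exact O.add_mem _ _ (ih hb) (ih hc)
    · exact O.mul_mem _ _ (ih hb) (ih hc)
    · have := O.mul_mem _ _ (ih hb) (hN c hcN)
      rwa [mul_inv_cancel_right₀ (ne_zero_of_notMem_polar hcN)] at this
    · by_contra hx
      have hx0 : x ≠ 0 := fun h => hx (h ▸ O.zero_mem)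
      have h1 := hO _ (ValuationSubring.mul_mem_nonunits (ih hc)
        (ValuationSubring.inv_mem_nonunits_of_notMem hx))
      exact h _ h1 (by field_simp)

end boundedChain

end BoundedChain

/-! ### Unbounded integers are impossible. -/

section Archimedean

open Subgroup

namespace boundedChain

variable {K : Type u} [Field K] {T : Subgroup Kˣ} {a x : K} {i j : ℕ}

theorem natCast_mem (d : ℕ) : (d : K) ∈ boundedChain T a d := by
  induction d with
  | zero => simpa using zero_mem
  | succ d ih => simpa using add_mem ih one_mem

variable (ha0 : a ≠ 0) (haT : a ∉ T.fieldSet) (hunb : ∀ i, ∃ n : ℕ, (n : K) ∉ boundedChain T a i)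

include ha0 haT hunb

theorem exists_natCast_inv_mem_polar (j : ℕ) :
    ∃ N : ℕ, 0 < N ∧ (N : K)⁻¹ ∈ unitPolar T (boundedChain T a j) := by
  obtain ⟨N, hN⟩ := hunb (j + 2)
  refine ⟨N, Nat.pos_of_ne_zero fun h => hN (by simpa [h] using zero_mem), ?_⟩
  exact polar_anti (Nat.le_succ j) (inv_mem_polar_of_notMem ha0 haT hN)

variable [CharZero K]

/-- Rational numbers greater than one are bounded away from zero: otherwise expanding the natural
numbers in such a rational base would bound them. -/
theorem div_notMem_polar {m n : ℕ} (hn : 0 < n) (hnm : n < m) :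
    (m / n : K) ∉ unitPolar T (boundedChain T a 4) := by
  intro hρ
  obtain ⟨N, hN, hNs⟩ := exists_natCast_inv_mem_polar ha0 haT hunb (m + 1)
  have hN0 : (N : K) ≠ 0 := by exact_mod_cast hN.ne'
  have hn0 : (n : K) ≠ 0 := by exact_mod_cast hn.ne'
  -- Write X = (X mod m) + (m/n) · n⌊X/m⌋ and use n⌊X/m⌋ < X. Scaling by N⁻¹ puts all digits into
  -- E_1, and m/n maps E_3 into E_1, so the index never grows.
  have key : ∀ X : ℕ, (N : K)⁻¹ * X ∈ boundedChain T a 3 := by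
    intro X
    induction X using Nat.strong_induction_on with
    | _ X ih =>
      have hd : (N : K)⁻¹ * (X % m : ℕ) ∈ boundedChain T a 2 := by
        refine mono (by norm_num) (polar_subset ha0 haT (polar_mul_mem hNs ?_))
        exact mono (Nat.mod_lt X (by omega)).le (natCast_mem _)
      rcases Nat.eq_zero_or_pos (X / m) with h0 | h0
      · have := Nat.div_add_mod X m
        rw [h0, mul_zero, zero_add] at this
        rw [this] at hd
        exact le_succ hd
      have hlt : n * (X / m) < X := by
        calc n * (X / m) < m * (X / m) := Nat.mul_lt_mul_of_pos_right hnm h0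
          _ ≤ X := Nat.mul_div_le X m
      have h1 := polar_subset ha0 haT (polar_mul_mem hρ (ih _ hlt))
      have h2 := add_mem hd (mono (show 1 ≤ 2 by norm_num) h1)
      convert h2 using 1
      conv_lhs => rw [← Nat.div_add_mod X m]
      push_cast
      field_simp
      ring
  obtain ⟨X, hX⟩ := hunb (max N 3 + 1)
  refine hX ?_
  have h := mul_mem (mono (le_max_left N 3) (natCast_mem (T := T) (a := a) N))
    (mono (le_max_right N 3) (key X))
  rwa [mul_inv_cancel_left₀ hN0] at h

theorem div_mem_of_le {k n : ℕ} (hn : 0 < n) (hk : k ≤ n) :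
    (k / n : K) ∈ boundedChain T a 5 := by
  have hn0 : (n : K) ≠ 0 := by exact_mod_cast hn.ne'
  rcases Nat.eq_zero_or_pos k with rfl | hk0
  · simpa using zero_mem
  rcases hk.eq_or_lt with rfl | hlt
  · rw [div_self hn0]
    exact one_mem
  have h := div_notMem_polar ha0 haT hunb hk0 hlt
  rw [← inv_div]
  by_cases h4 : (n / k : K) ∈ boundedChain T a 4
  · exact inv_mem h4 h
  · exact le_succ (inv_mem_of_notMem ha0 haT h4)

/-- Walk from 1 to x in N equal steps. While the current point is away from zero its inverse is
bounded, so each step multiplies by an element 1 + N⁻¹ · (bounded) of `T`. -/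
theorem mem_of_segment {s N : ℕ} (hs : 7 ≤ s) (hN : 0 < N)
    (hNs : (N : K)⁻¹ ∈ unitPolar T (boundedChain T a (s + 2))) (hx : x ∈ boundedChain T a 0)
    (hp : ∀ i ≤ N, 1 + (x - 1) * (i / N) ∉ unitPolar T (boundedChain T a s)) :
    x ∈ T.fieldSet := by
  have hN0 : (N : K) ≠ 0 := by exact_mod_cast hN.ne'
  have hx1 : x - 1 ∈ boundedChain T a 1 := by
    rw [sub_eq_add_neg]
    exact add_mem hx neg_one_mem
  have key : ∀ i ≤ N, 1 + (x - 1) * (i / N) ∈ T.fieldSet := by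
    intro i
    induction i with
    | zero => intro _; simpa using one_mem_fieldSet
    | succ i ih =>
      intro hi
      have h1 := ih (by omega)
      have h0 := fieldSet_ne_zero h1
      have hE : 1 + (x - 1) * (i / N) ∈ boundedChain T a s := by
        refine mono hs (add_mem one_mem (mul_mem (mono (by norm_num) hx1) ?_))
        exact div_mem_of_le ha0 haT hunb hN (by omega)
      have h2 := inv_mem hE (hp i (by omega))
      have h3 := hNs _ (mul_mem (mono (by omega) hx1) h2)
      have e : 1 + (x - 1) * ((i + 1 : ℕ) / N) = (1 + (x - 1) * (i / N)) *
          (1 + (N : K)⁻¹ * ((x - 1) * (1 + (x - 1) * (i / N))⁻¹)) := by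
        push_cast
        generalize hy : 1 + (x - 1) * ((i : K) / N) = y at h0 ⊢
        have : (1 : K) + (x - 1) * ((i + 1) / N) = y + (x - 1) / N := by rw [← hy]; ring
        rw [this]
        field_simp
      rw [e]
      exact mul_mem_fieldSet h1 h3
  have := key N le_rfl
  rwa [div_self hN0, mul_one, add_sub_cancel] at this

/-- If `-1 ∈ T` and the natural numbers are unbounded, then the topology is archimedean and open
subgroups are everything. -/
theorem false_of_natCast_unbounded (hneg : (-1 : K) ∈ T.fieldSet) : False := by
  obtain ⟨N, hN, hNs⟩ := exists_natCast_inv_mem_polar ha0 haT hunb 32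
  have hN0 : (N : K) ≠ 0 := by exact_mod_cast hN.ne'
  have h1 : ∃ i ≤ N, 1 + (a - 1) * (i / N) ∈ unitPolar T (boundedChain T a 30) := by
    by_contra! h
    exact haT (mem_of_segment ha0 haT hunb (by norm_num) hN hNs self_mem h)
  have h2 : ∃ i ≤ N, 1 + (-a - 1) * (i / N) ∈ unitPolar T (boundedChain T a 30) := by
    by_contra! h
    have := mem_of_segment ha0 haT hunb (by norm_num) hN hNs
      (by simp [boundedChain]) h
    rw [← neg_one_mul, mul_mem_fieldSet_iff hneg] at this
    exact haT this
  obtain ⟨i, hi, hε⟩ := h1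
  obtain ⟨k, hk, hε'⟩ := h2
  have hr : (i / N : K) ∈ boundedChain T a 5 := div_mem_of_le ha0 haT hunb hN hi
  have hr' : (k / N : K) ∈ boundedChain T a 5 := div_mem_of_le ha0 haT hunb hN hk
  have hs : (1 - i / N : K) ∈ boundedChain T a 5 := by
    have := div_mem_of_le ha0 haT hunb hN (Nat.sub_le N i)
    rwa [Nat.cast_sub hi, sub_div, div_self hN0] at this
  -- With r = i/N and r' = k/N, the combination r' ε + r ε' of the two small points cancels a. It is
  -- a sum of two nonnegative rationals, so each summand is a fraction at most 1 of it, hence small.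
  have hη : (k / N : K) * (1 - i / N) + i / N * (1 - k / N) ∈
      unitPolar T (boundedChain T a 26) := by
    have h1 := polar_mul_mem (i := 29) hε (mono (by norm_num) hr')
    have h2 := polar_mul_mem (i := 29) hε' (mono (by norm_num) hr)
    convert polar_add_mem ha0 haT h1 h2 using 1
    ring
  have hα : (k / N : K) * (1 - i / N) ∈ unitPolar T (boundedChain T a 25) := by
    rcases Nat.eq_zero_or_pos (k * (N - i) + i * (N - k)) with h0 | h0
    · have : k * (N - i) = 0 := by omega
      have h3 : (k : K) * (N - i) = 0 := by
        rw [← Nat.cast_sub hi]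
        exact_mod_cast this
      have h4 : (k / N : K) * (1 - i / N) = 0 := by
        have : (k / N : K) * (1 - i / N) = k * (N - i) / N ^ 2 := by field_simp
        rw [this, h3, zero_div]
      rw [h4]
      exact zero_mem_polar
    · have h3 := div_mem_of_le ha0 haT hunb h0 (Nat.le_add_right (k * (N - i)) (i * (N - k)))
      have h4 := polar_mul_mem (i := 25) hη (mono (by norm_num) h3)
      convert h4 using 1
      have h5 : ((k * (N - i) + i * (N - k) : ℕ) : K) ≠ 0 := by exact_mod_cast h0.ne'
      push_cast [Nat.cast_sub hi, Nat.cast_sub hk] at h5 ⊢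
      have : (k / N : K) * (1 - i / N) + i / N * (1 - k / N) =
          (k * (N - i) + i * (N - k)) / N ^ 2 := by field_simp
      rw [this]
      field_simp
  -- Neither factor of the small product r'(1 - r) is small: ε' + r'(1 + a) = 1 and ε + (1 - r)(a -
  -- 1) = a. Inverting both makes 1 small.
  have hr'N : (k / N : K) ∉ unitPolar T (boundedChain T a 20) := by
    intro h
    have h1 : (1 + a : K) ∈ boundedChain T a 19 := mono (by norm_num) (add_mem (i := 0) one_mem self_mem)
    have h2 := polar_mul_mem h h1
    have h3 := polar_add_mem (i := 16) ha0 haT (polar_anti (by norm_num) hε') h2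
    refine one_notMem_polar (T := T) (a := a) (i := 16) ?_
    convert h3 using 1
    ring
  have hsN : (1 - i / N : K) ∉ unitPolar T (boundedChain T a 20) := by
    intro h
    have h1 : (a + -1 : K) ∈ boundedChain T a 19 :=
      mono (by norm_num) (add_mem (i := 0) self_mem neg_one_mem)
    have h2 := polar_mul_mem h h1
    have h3 := polar_add_mem (i := 16) ha0 haT (polar_anti (by norm_num) hε) h2
    refine self_notMem_polar (T := T) (a := a) (i := 16) ha0 ?_
    convert h3 using 1
    ring
  have h1 := mul_mem (inv_mem (mono (by norm_num) hr') hr'N) (inv_mem (mono (by norm_num) hs) hsN)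
  have h2 := polar_mul_mem (i := 24) hα (mono (by norm_num) h1)
  rw [← mul_inv, mul_inv_cancel₀ (mul_ne_zero (ne_zero_of_notMem_polar hr'N)
    (ne_zero_of_notMem_polar hsN))] at h2
  exact one_notMem_polar h2

end boundedChain

end Archimedean

/-! ### Bounded integers: a finer valuation ring from a sequence of balls. -/

section NonArchimedean

open Subgroup

/-- The number of monomials of degree `R` in `n` variables is eventually less than `2 ^ R / 4`. -/
theorem exists_card_sym_le_two_pow (n : ℕ) :
    ∃ j, ((Finset.univ : Finset (Fin n)).sym (j + 2)).card ≤ 2 ^ j := by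
  rcases Nat.eq_zero_or_pos n with rfl | hn
  · exact ⟨0, by simp⟩
  have h := (tendsto_pow_const_div_const_pow_of_one_lt n (one_lt_two : (1 : ℝ) < 2)).eventually
    (gt_mem_nhds (show (0 : ℝ) < 1 / 2 ^ (n + 2) by positivity))
  obtain ⟨M, hM1, hM⟩ := (h.and (Filter.eventually_ge_atTop (n + 2))).exists
  obtain ⟨j, rfl⟩ := Nat.exists_eq_add_of_le hM
  refine ⟨j, ?_⟩
  have h1 : (n + 2 + j) ^ n ≤ 2 ^ j := by
    rw [div_lt_div_iff₀ (by positivity) (by positivity), one_mul, pow_add (2 : ℝ) (n + 2) j,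
      mul_comm ((2 : ℝ) ^ (n + 2))] at hM1
    have := lt_of_mul_lt_mul_right hM1 (by positivity)
    exact_mod_cast this.le
  have h2 : ((Finset.univ : Finset (Fin n)).sym (j + 2)).card = n.multichoose (j + 2) := by
    rw [Finset.sym_univ, Finset.card_univ, Sym.card_sym_fin_eq_multichoose]
  rw [h2, Nat.multichoose_eq]
  calc (n + (j + 2) - 1).choose (j + 2) = (n + (j + 2) - 1).choose (n - 1) := by
        rw [← Nat.choose_symm (by omega)]; congr 1; omega
    _ ≤ (n + (j + 2) - 1) ^ (n - 1) := Nat.choose_le_pow _ _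
    _ ≤ (n + 2 + j) ^ (n - 1) := Nat.pow_le_pow_left (by omega) _
    _ ≤ (n + 2 + j) ^ n := Nat.pow_le_pow_right (by omega) (by omega)
    _ ≤ 2 ^ j := h1

/-- A decreasing sequence of sets that behave like the balls of radius `c ^ e`. -/
structure IsBallSequence {K : Type u} [Field K] (W : ℕ → Set K) : Prop where
  zero_mem : ∀ e, 0 ∈ W e
  one_mem : 1 ∈ W 0
  one_notMem : 1 ∉ W 1
  add_mem : ∀ e x y, x ∈ W (e + 1) → y ∈ W (e + 1) → x + y ∈ W e
  mul_mem : ∀ e d x y, x ∈ W (e + 1) → y ∈ W d → x * y ∈ W (e + d)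
  intCast_mul_mem : ∀ e (z : ℤ) x, x ∈ W (e + 1) → z * x ∈ W e
  le : ∀ e, W (e + 1) ⊆ W e

namespace IsBallSequence

variable {K : Type u} [Field K] {W : ℕ → Set K} (h : IsBallSequence W)

include h

/-- Halving the index set repeatedly, a sum of 2^j terms costs only j in the radius. -/
theorem sum_mem {ι : Type*} [DecidableEq ι] {e : ℕ} (j : ℕ) (s : Finset ι) (f : ι → K)
    (hs : s.card ≤ 2 ^ j) (hf : ∀ i ∈ s, f i ∈ W (e + j)) : ∑ i ∈ s, f i ∈ W e := by
  induction j generalizing e s with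
  | zero =>
    rcases s.eq_empty_or_nonempty with rfl | hne
    · simpa using h.zero_mem e
    · obtain ⟨i, rfl⟩ := Finset.card_eq_one.mp (le_antisymm (by simpa using hs) hne.card_pos)
      simpa using hf i (by simp)
  | succ j ih =>
    obtain ⟨t, hts, htc⟩ := Finset.exists_subset_card_eq (Nat.div_le_self s.card 2)
    rw [← Finset.sum_sdiff hts]
    have hc := Finset.card_sdiff_add_card_eq_card hts
    rw [pow_succ] at hs
    refine h.add_mem e _ _ (ih _ (by omega) fun i hi => ?_) (ih _ (by omega) fun i hi => ?_)
    · have := hf i (Finset.sdiff_subset hi)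
      rwa [add_right_comm]
    · have := hf i (hts hi)
      rwa [add_right_comm]

theorem prod_mem (m : Multiset K) (hm : ∀ x ∈ m, x ∈ W 2) : m.prod ∈ W m.card := by
  induction m using Multiset.induction_on with
  | empty => simpa using h.one_mem
  | cons x m ih =>
    rw [Multiset.prod_cons, Multiset.card_cons, add_comm]
    exact h.mul_mem 1 _ _ _ (hm x (Multiset.mem_cons_self x m))
      (ih fun y hy => hm y (Multiset.mem_cons_of_mem hy))

/-- Raise a relation 1 = Σ f_i g_i to the power j + 2. Each monomial lies in `W (j + 2)`, its
multinomial coefficient costs one, and summing at most 2^j of them costs j, which leaves 1 in `W 1`.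
-/
theorem one_notMem_span : (1 : K) ∉ Submodule.span ℤ (W 3) := by
  intro h1
  obtain ⟨n, f, g, hfg⟩ := (Submodule.mem_span_set').mp h1
  obtain ⟨j, hj⟩ := exists_card_sym_le_two_pow n
  refine h.one_notMem ?_
  rw [show (1 : K) = (∑ i, f i • (g i : K)) ^ (j + 2) by rw [hfg, one_pow], Finset.sum_pow]
  refine h.sum_mem j _ _ hj fun k hk => ?_
  have hp : (k.val.map fun i => f i • (g i : K)).prod ∈ W (j + 2) := by
    have := h.prod_mem (k.val.map fun i => f i • (g i : K)) ?_
    · rwa [Multiset.card_map, k.2] at this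
    · intro x hx
      obtain ⟨i, -, rfl⟩ := Multiset.mem_map.mp hx
      rw [zsmul_eq_mul]
      exact h.intCast_mul_mem 2 _ _ (g i).2
  have := h.intCast_mul_mem (j + 1) (k.val.countPerms : ℤ) _ hp
  rw [add_comm 1 j]
  simpa using this

theorem span_mul_mem {x y : K} (hx : x ∈ Submodule.span ℤ (W 3))
    (hy : y ∈ Submodule.span ℤ (W 3)) : x * y ∈ Submodule.span ℤ (W 3) := by
  have h1 := Submodule.mul_mem_mul hx hy
  rw [Submodule.span_mul_span] at h1
  refine Submodule.span_mono ?_ h1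
  rintro _ ⟨x, hx, y, hy, rfl⟩
  exact h.le _ (h.le _ (h.mul_mem 2 3 x y hx hy))

/-- A ball of small radius is contained in the maximal ideal of some valuation ring. -/
theorem exists_valuationSubring : ∃ O : ValuationSubring K, W 3 ⊆ O.nonunits := by
  let J := Submodule.span ℤ (W 3)
  -- A is the multiplier ring of J. As J is closed under multiplication, it is an ideal of A, proper
  -- because 1 ∉ J, so some valuation ring dominates it.
  let A : Subring K :=
    { carrier := {x | ∀ y ∈ J, x * y ∈ J}
      mul_mem' := fun {a b} ha hb y hy => by rw [mul_assoc]; exact ha _ (hb _ hy)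
      one_mem' := fun y hy => by rwa [one_mul]
      add_mem' := fun {a b} ha hb y hy => by rw [add_mul]; exact J.add_mem (ha _ hy) (hb _ hy)
      zero_mem' := fun y _ => by rw [zero_mul]; exact J.zero_mem
      neg_mem' := fun {a} ha y hy => by rw [neg_mul]; exact J.neg_mem (ha _ hy) }
  let I : Ideal A :=
    { carrier := {x | (x : K) ∈ J}
      add_mem' := fun {a b} ha hb => J.add_mem ha hb
      zero_mem' := J.zero_mem
      smul_mem' := fun c {x} hx => c.2 _ hx }
  have hI : I ≠ ⊤ := fun hI => by
    have : (1 : A) ∈ I := hI ▸ Submodule.mem_top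
    exact h.one_notMem_span this
  obtain ⟨O, -, hO⟩ := Ideal.image_subset_nonunits_valuationSubring I hI
  refine ⟨O, fun x hx => hO ?_⟩
  have hxJ : x ∈ J := Submodule.subset_span hx
  exact ⟨⟨x, fun y hy => h.span_mul_mem hxJ hy⟩, hxJ, rfl⟩

end IsBallSequence

namespace boundedChain

variable {K : Type u} [Field K] {T : Subgroup Kˣ} {a : K} (ha0 : a ≠ 0) (haT : a ∉ T.fieldSet)

include ha0 haT

/-- A spare factor c absorbs the index lost by a sum, a product or an integer multiple, since c
E_{r+1} ⊆ E_1 ⊆ E_r. -/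
theorem isBallSequence {r : ℕ} (hr : 1 ≤ r) (hZ : ∀ z : ℤ, (z : K) ∈ boundedChain T a r) {c : K}
    (hc : c ∈ unitPolar T (boundedChain T a (r + 2))) :
    IsBallSequence (fun e => {x | ∃ b ∈ boundedChain T a r, x = c ^ e * b}) := by
  have hcE : ∀ b ∈ boundedChain T a (r + 1), c * b ∈ boundedChain T a r :=
    fun b hb => mono hr (polar_subset ha0 haT (polar_mul_mem hc hb))
  refine ⟨fun e => ⟨0, zero_mem, by simp⟩, ⟨1, one_mem, by simp⟩, ?_, ?_, ?_, ?_, ?_⟩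
  · rintro ⟨b, hb, h⟩
    have := polar_mul_mem hc (le_succ hb)
    rw [pow_one] at h
    rw [← h] at this
    exact one_notMem_polar this
  · rintro e _ _ ⟨b, hb, rfl⟩ ⟨d, hd, rfl⟩
    exact ⟨_, hcE _ (add_mem hb hd), by ring⟩
  · rintro e e' _ _ ⟨b, hb, rfl⟩ ⟨d, hd, rfl⟩
    exact ⟨_, hcE _ (mul_mem hb hd), by ring⟩
  · rintro e z _ ⟨b, hb, rfl⟩
    exact ⟨_, hcE _ (mul_mem (hZ z) hb), by ring⟩
  · rintro e _ ⟨b, hb, rfl⟩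
    exact ⟨_, hcE _ (le_succ hb), by ring⟩

/-- If the integers are bounded and the chain does not become stationary, then `T` is open with
respect to a valuation finer than the one given by the chain. -/
theorem exists_finer_of_int_bounded {r : ℕ} (hZ : ∀ z : ℤ, (z : K) ∈ boundedChain T a r)
    (hne : ∀ i, ∃ x ∈ union ha0 haT, x ∉ boundedChain T a i) :
    ∃ O : ValuationSubring K, O ≤ union ha0 haT ∧
      ∃ f ∈ O, f ∉ (union ha0 haT).nonunits ∧ ∀ x ∈ O, 1 + f * x ∈ T.fieldSet := by
  replace hZ : ∀ z : ℤ, (z : K) ∈ boundedChain T a (r + 1) := fun z => le_succ (hZ z)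
  obtain ⟨x, hxG, hx⟩ := hne (r + 4)
  have hx0 := ne_zero_of_notMem hx
  have hcN : x⁻¹ ∈ unitPolar T (boundedChain T a (r + 3)) := inv_mem_polar_of_notMem ha0 haT hx
  have hW := isBallSequence ha0 haT (Nat.le_add_left 1 r) hZ hcN
  obtain ⟨O, hO⟩ := hW.exists_valuationSubring
  have hball : ∀ b ∈ boundedChain T a (r + 1), x⁻¹ ^ 3 * b ∈ O.nonunits :=
    fun b hb => hO ⟨b, hb, rfl⟩
  have hle : O ≤ union ha0 haT := by
    intro y hy
    by_contra hyG
    have h1 := ValuationSubring.inv_mem_nonunits_of_notMem hyG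
    have h2 := ValuationSubring.mul_mem_nonunits (pow_mem hxG 3) h1
    have h3 := union_nonunits_subset ha0 haT (i := 0) h2
    have h4 := hball _ (mono (Nat.le_add_left 1 r) (polar_subset ha0 haT h3))
    rw [inv_pow, inv_mul_cancel_left₀ (pow_ne_zero 3 hx0)] at h4
    have hy0 : y ≠ 0 := fun h => hyG (h ▸ ValuationSubring.zero_mem _)
    exact ValuationSubring.inv_notMem_nonunits hy hy0 h4
  obtain ⟨q, hq⟩ := (mem_union ha0 haT).mp (pow_mem hxG 3)
  -- If y⁻¹x³ were in E_{r+1}, the ball condition would put y⁻¹ into 𝔪_O. So y x⁻³ is in E_{r+1},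
  -- and multiplying by x³ bounds all of `O` in one stage.
  have hbdd : ∀ y ∈ O, y ∈ boundedChain T a (max q (r + 1) + 1) := by
    intro y hy
    rcases eq_or_ne y 0 with rfl | hy0
    · exact zero_mem
    have h1 : (y * x⁻¹ ^ 3)⁻¹ ∉ boundedChain T a (r + 1) := fun h => by
      have h2 := hball _ h
      rw [mul_inv, mul_left_comm, mul_inv_cancel₀ (pow_ne_zero 3 (inv_ne_zero hx0)), mul_one] at h2
      exact ValuationSubring.inv_notMem_nonunits hy hy0 h2
    have h2 := inv_mem_of_notMem ha0 haT h1
    have h3 := mul_mem (mono (le_max_left q (r + 1)) hq) (mono (le_max_right q (r + 1)) h2)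
    rwa [inv_inv, mul_left_comm, inv_pow, mul_inv_cancel₀ (pow_ne_zero 3 hx0), mul_one] at h3
  obtain ⟨x', hxG', hx'⟩ := hne (max q (r + 1) + 1 + 1)
  have hx0' := ne_zero_of_notMem hx'
  have hf := inv_mem_polar_of_notMem ha0 haT (i := max q (r + 1)) hx'
  -- The factor x'⁻¹ is small against the bound on `O`; the factor x⁻³ puts f into `O`. Both x and
  -- x' lie in the union, so f is not in its maximal ideal.
  refine ⟨O, hle, x⁻¹ ^ 3 * x'⁻¹, ?_, ?_, fun y hy => ?_⟩
  · exact ValuationSubring.mem_of_mem_nonunits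
      (hball _ (mono (Nat.le_add_left 1 r) (polar_subset ha0 haT hf)))
  · have : x⁻¹ ^ 3 * x'⁻¹ = (x ^ 3 * x')⁻¹ := by rw [mul_inv, inv_pow]
    rw [this]
    exact ValuationSubring.inv_notMem_nonunits
      (ValuationSubring.mul_mem _ _ _ (pow_mem hxG 3) hxG') (mul_ne_zero (pow_ne_zero 3 hx0) hx0')
  · have h1 : x⁻¹ ^ 3 * y ∈ O := by
      have := ValuationSubring.mem_of_mem_nonunits (hball 1 one_mem)
      rw [mul_one] at this
      exact O.mul_mem _ _ this hy
    have h2 := hf _ (hbdd _ h1)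
    convert h2 using 2
    ring

end boundedChain

end NonArchimedean

/-! ### Weak compatibility, Newton approximation and the dichotomy. -/

section WeakCompatibility

open Subgroup

variable {K : Type u} [Field K]

namespace ValuationSubring

/-- `1 + 𝔪 ⊆ T`. -/
def Compatible (O : ValuationSubring K) (T : Subgroup Kˣ) : Prop :=
  ∀ x ∈ O.nonunits, 1 + x ∈ T.fieldSet

/-- `1 + f O ⊆ T` for some `f ∈ 𝔪` such that the radical of `f O` is `𝔪`. -/
def WeaklyCompatible (O : ValuationSubring K) (T : Subgroup Kˣ) (f : K) : Prop :=
  f ∈ O.nonunits ∧ (∀ x ∈ O, 1 + f * x ∈ T.fieldSet) ∧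
    ∀ x ∈ O.nonunits, ∃ n : ℕ, ∃ y ∈ O, x ^ n = f * y

variable {O G : ValuationSubring K} {T T' : Subgroup Kˣ} {f : K}

theorem WeaklyCompatible.mono (h : O.WeaklyCompatible T f) (hT : T ≤ T') :
    O.WeaklyCompatible T' f := ⟨h.1, fun x hx =>
  let ⟨t, ht, e⟩ := h.2.1 x hx
  ⟨t, hT ht, e⟩, h.2.2⟩

/-- In a valuation ring, radicals of ideals are prime. -/
theorem isPrime_radical {I : Ideal O} (hI : I ≠ ⊤) : I.radical.IsPrime := by
  refine ⟨by rwa [Ne, Ideal.radical_eq_top], fun {x y} hxy => ?_⟩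
  rcases ValuationRing.dvd_total x y with ⟨z, rfl⟩ | ⟨z, rfl⟩
  · refine .inr (Ideal.radical_isRadical I ⟨2, ?_⟩)
    have := I.radical.mul_mem_right z hxy
    convert this using 1
    ring
  · refine .inl (Ideal.radical_isRadical I ⟨2, ?_⟩)
    have := I.radical.mul_mem_right z hxy
    convert this using 1
    ring

/-- Localize `O` at the radical of f`O`, which becomes the maximal ideal of `u` and still lies in
`O`. Taking g = f² works because f`u` ⊆ 𝔪_u ⊆ `O`; and `u` ≤ `G` because x/f ∈ 𝔪_G ⊆ `O` for x ∈
𝔪_G. -/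
theorem exists_weaklyCompatible_of_finer (hOG : O ≤ G) (hfO : f ∈ O) (hfG : f ∉ G.nonunits)
    (hf : ∀ x ∈ O, 1 + f * x ∈ T.fieldSet) :
    ∃ u ≤ G, ∃ g, u.WeaklyCompatible T g ∧ g ∉ G.nonunits := by
  have hf0 : f ≠ 0 := fun h => hfG (h ▸ G.nonunits.zero_mem)
  let I : Ideal O := Ideal.span {⟨f, hfO⟩}
  have hI : I ≠ ⊤ := by
    intro h
    rw [Ideal.eq_top_iff_one, Ideal.mem_span_singleton'] at h
    obtain ⟨y, hy⟩ := h
    have h1 : (y : K) * f = 1 := congrArg Subtype.val hy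
    have h2 := hf _ (O.neg_mem _ y.2)
    rw [mul_neg, mul_comm f, h1, add_neg_cancel] at h2
    exact zero_notMem_fieldSet h2
  have hP := isPrime_radical hI
  let u := O.ofPrime I.radical
  have hOu : O ≤ u := O.le_ofPrime _
  have hsub : ∀ x ∈ u.nonunits, x ∈ O := fun x hx =>
    mem_of_mem_nonunits (nonunits_le_nonunits.mpr hOu hx)
  have hmem : ∀ x ∈ O, x ∈ u.nonunits ↔ ∃ n : ℕ, ∃ y ∈ O, x ^ n = f * y := by
    intro x hx
    have h1 : x ∈ u.nonunits ↔ (⟨x, hx⟩ : O) ∈ O.idealOfLE u hOu :=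
      coe_mem_nonunits_iff (A := u) (a := ⟨x, hOu hx⟩)
    rw [h1, idealOfLE_ofPrime, Ideal.mem_radical_iff]
    refine exists_congr fun n => ?_
    rw [Ideal.mem_span_singleton']
    refine ⟨fun ⟨y, hy⟩ => ⟨y, y.2, ?_⟩, fun ⟨y, hy, e⟩ => ⟨⟨y, hy⟩, Subtype.ext ?_⟩⟩
    · rw [mul_comm]
      exact (congrArg Subtype.val hy).symm
    · rw [mul_comm] at e
      exact e.symm
  have hfu : f ∈ u.nonunits := (hmem f hfO).mpr ⟨1, 1, O.one_mem, by simp⟩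
  refine ⟨u, ?_, f ^ 2, ⟨?_, fun x hx => ?_, fun x hx => ?_⟩, fun h => ?_⟩
  · rw [← nonunits_le_nonunits]
    intro x hx
    have h1 : x * f⁻¹ ∈ G.nonunits := by
      rw [mul_comm]
      exact mul_mem_nonunits (inv_mem_of_notMem_nonunits hfG) hx
    have h2 : x * f⁻¹ ∈ O := mem_of_mem_nonunits (nonunits_le_nonunits.mpr hOG h1)
    have h3 : x ∈ O := mem_of_mem_nonunits (nonunits_le_nonunits.mpr hOG hx)
    exact (hmem x h3).mpr ⟨1, _, h2, by field_simp⟩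
  · rw [pow_two]
    exact u.nonunits.mul_mem hfu hfu
  · have := hf _ (hsub _ (mul_mem_nonunits hx hfu))
    convert this using 2
    ring
  · obtain ⟨n, y, hy, e⟩ := (hmem x (hsub x hx)).mp hx
    exact ⟨n * 2, y ^ 2, pow_mem (hOu hy) 2, by rw [pow_mul, e, mul_pow]⟩
  · have := mul_mem_nonunits (inv_mem_of_notMem_nonunits hfG) h
    rw [pow_two, inv_mul_cancel_left₀ hf0] at this
    exact hfG this

/-- Newton approximation: if `n` is a unit of `O` and `T` contains the `n`-th powers, then weak
compatibility implies compatibility. -/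
theorem WeaklyCompatible.compatible (h : O.WeaklyCompatible T f) {n : ℕ}
    (hn : (n : K) ∉ O.nonunits) (hT : ∀ x : K, x ≠ 0 → x ^ n ∈ T.fieldSet) : O.Compatible T := by
  have hn' : (n : K)⁻¹ ∈ O := inv_mem_of_notMem_nonunits hn
  have hn0 : (n : K) ≠ 0 := fun h => hn (h ▸ O.nonunits.zero_mem)
  -- One Newton step with s = (1 + y/n)^n, which agrees with 1 + y up to y²`O`. Iterating drives the
  -- error into f`O`.
  have step : ∀ y ∈ O.nonunits, ∃ s ∈ T.fieldSet, ∃ z ∈ O, 1 + y = s * (1 + y ^ 2 * z) := by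
    intro y hy
    have hy1 := mul_mem_nonunits hn' hy
    obtain ⟨k, hk⟩ := Polynomial.powAddExpansion (1 : O) ⟨_, mem_of_mem_nonunits hy1⟩ n
    have hk' : (1 + (n : K)⁻¹ * y) ^ n = 1 + n * ((n : K)⁻¹ * y) + k * ((n : K)⁻¹ * y) ^ 2 := by
      have := congrArg (Subtype.val : O → K) hk
      simpa using this
    rw [mul_inv_cancel_left₀ hn0] at hk'
    have h1 : (1 + (n : K)⁻¹ * y) ≠ 0 := fun h => one_add_notMem_nonunits hy1
      (h ▸ O.nonunits.zero_mem)
    have h2 : ((1 + (n : K)⁻¹ * y) ^ n)⁻¹ ∈ O := by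
      rw [← inv_pow]
      exact pow_mem (inv_mem_of_notMem_nonunits (one_add_notMem_nonunits hy1)) n
    refine ⟨_, hT _ h1, -(k * (n : K)⁻¹ ^ 2 * ((1 + (n : K)⁻¹ * y) ^ n)⁻¹),
      O.neg_mem _ (O.mul_mem _ _ (O.mul_mem _ _ k.2 (pow_mem hn' 2)) h2), ?_⟩
    have h3 := pow_ne_zero n h1
    generalize (1 + (n : K)⁻¹ * y) ^ n = q at hk' h3
    have : q * (1 + y ^ 2 * -(k * (n : K)⁻¹ ^ 2 * q⁻¹)) =
        q - k * ((n : K)⁻¹ * y) ^ 2 * (q * q⁻¹) := by ring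
    rw [this, mul_inv_cancel₀ h3, hk']
    ring
  have key : ∀ j : ℕ, ∀ x ∈ O.nonunits, ∃ s ∈ T.fieldSet, ∃ z ∈ O,
      1 + x = s * (1 + x ^ (j + 1) * z) := by
    intro j x hx
    induction j with
    | zero => exact ⟨1, one_mem_fieldSet, 1, O.one_mem, by ring⟩
    | succ j ih =>
      obtain ⟨s, hs, z, hz, e⟩ := ih
      have hy : x ^ (j + 1) * z ∈ O.nonunits := by
        rw [mul_comm, pow_succ]
        exact mul_mem_nonunits hz (mul_mem_nonunits (pow_mem (mem_of_mem_nonunits hx) j) hx)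
      obtain ⟨s', hs', z', hz', e'⟩ := step _ hy
      refine ⟨s * s', mul_mem_fieldSet hs hs', x ^ j * z ^ 2 * z', O.mul_mem _ _ (O.mul_mem _ _
        (pow_mem (mem_of_mem_nonunits hx) j) (pow_mem hz 2)) hz', ?_⟩
      rw [e, e']
      ring
  intro x hx
  obtain ⟨m, y, hy, e⟩ := h.2.2 x hx
  obtain ⟨s, hs, z, hz, e'⟩ := key m x hx
  have hxO := mem_of_mem_nonunits hx
  have : x ^ (m + 1) * z = f * (y * x * z) := by rw [pow_succ, e]; ring
  rw [e', this]
  exact mul_mem_fieldSet hs (h.2.1 _ (O.mul_mem _ _ (O.mul_mem _ _ hy hxO) hz))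

/-- There are minimal valuation rings compatible with a given subgroup. -/
theorem Compatible.exists_minimal (h : O.Compatible T) :
    ∃ u ≤ O, u.Compatible T ∧ ∀ u' ≤ u, u'.Compatible T → u' = u := by
  obtain ⟨m, hm, hmax⟩ := zorn_le_nonempty₀ (α := (ValuationSubring K)ᵒᵈ)
    {u | (OrderDual.ofDual u).Compatible T} (fun c hc hchain y hy => by
      let R : ValuationSubring K :=
        { carrier := {x | ∀ u ∈ c, x ∈ OrderDual.ofDual u}
          mul_mem' := fun ha hb u hu => ValuationSubring.mul_mem _ _ _ (ha u hu) (hb u hu)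
          one_mem' := fun u _ => ValuationSubring.one_mem _
          add_mem' := fun ha hb u hu => ValuationSubring.add_mem _ _ _ (ha u hu) (hb u hu)
          zero_mem' := fun u _ => ValuationSubring.zero_mem _
          neg_mem' := fun ha u hu => ValuationSubring.neg_mem _ _ (ha u hu)
          mem_or_inv_mem' := fun x => by
            by_contra hcon
            simp only [Set.mem_ofPred_eq, not_or, not_forall] at hcon
            obtain ⟨⟨u, hu, hxu⟩, u', hu', hxu'⟩ := hcon
            rcases hchain.total hu hu' with hle | hle
            · exact ((OrderDual.ofDual u').mem_or_inv_mem x).elim (fun h => hxu (hle h)) hxu'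
            · exact ((OrderDual.ofDual u).mem_or_inv_mem x).elim hxu (fun h => hxu' (hle h)) }
      refine ⟨OrderDual.toDual R, fun x hx => ?_, fun u hu x hx => hx u hu⟩
      -- The maximal ideal of the intersection of a chain is the union of the maximal ideals, so
      -- compatibility passes to the intersection.
      rcases (mem_nonunits_iff_or _).mp hx with rfl | hxR
      · simpa using one_mem_fieldSet
      · have : ∃ u ∈ c, x⁻¹ ∉ OrderDual.ofDual u := by
          by_contra! hcon
          exact hxR hcon
        obtain ⟨u, hu, hxu⟩ := this
        exact hc hu x ((mem_nonunits_iff_or _).mpr (.inr hxu)))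
    (OrderDual.toDual O) h
  exact ⟨OrderDual.ofDual m, hm, hmax.prop, fun u' hle hc =>
    le_antisymm hle (hmax.le_of_ge (y := OrderDual.toDual u') hc hle)⟩

end ValuationSubring

open ValuationSubring boundedChain in
/-- A proper definable subgroup `T` containing the `n`-th powers and compatible with a non-trivial
valuation either yields a definable valuation or is weakly compatible with a finer valuation whose
residue characteristic divides `n`. -/
theorem hasDefinableValuation_or_exists_weaklyCompatible [CharZero K] {T : Subgroup Kˣ}
    (hTd : FieldDefinable T.fieldSet) (htop : T ≠ ⊤) (hneg : (-1 : K) ∈ T.fieldSet) {n : ℕ}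
    (hn : ∀ x : K, x ≠ 0 → x ^ n ∈ T.fieldSet) {v : ValuationSubring K} (hv : v ≠ ⊤)
    (hvT : v.Compatible T) :
    HasDefinableValuation K ∨
      ∃ u ≤ v, (n : K) ∈ u.nonunits ∧ ∃ f, u.WeaklyCompatible T f := by
  obtain ⟨O, hOv, hOT, hmin⟩ := hvT.exists_minimal
  have hOtop : O ≠ ⊤ := fun h => hv (top_le_iff.mp (h ▸ hOv))
  by_cases hunits : ∀ x, x ∈ O → x ∉ O.nonunits → x ∈ T.fieldSet
  · exact .inl (hasDefinableValuation_of_units_subset hTd htop hunits)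
  push Not at hunits
  obtain ⟨a, haO, haN, haT⟩ := hunits
  have ha0 : a ≠ 0 := fun h => haN (h ▸ O.nonunits.zero_mem)
  obtain rfl : union ha0 haT = O := by
    refine hmin _ (fun x hx => ?_) fun x hx => ?_
    · obtain ⟨i, hi⟩ := (mem_union ha0 haT).mp hx
      exact subset_of_compatible hOT haO (inv_mem_of_notMem_nonunits haN) hi
    · have := union_nonunits_subset ha0 haT (i := 0) hx 1 one_mem
      rwa [mul_one] at this
  by_cases hst : ∃ i, ∀ x ∈ union ha0 haT, x ∈ boundedChain T a i
  · obtain ⟨i, hi⟩ := hst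
    refine .inl ⟨_, hOtop, ?_⟩
    have : (union ha0 haT : Set K) = boundedChain T a i :=
      Set.Subset.antisymm hi fun x hx => (mem_union ha0 haT).mpr ⟨i, hx⟩
    rw [this]
    exact fieldDefinable_boundedChain T hTd a i
  push Not at hst
  by_cases hZ : ∃ r, ∀ z : ℤ, (z : K) ∈ boundedChain T a r
  swap
  · exfalso
    push Not at hZ
    refine false_of_natCast_unbounded ha0 haT (fun i => ?_) hneg
    obtain ⟨z, hz⟩ := hZ (i + 1)
    refine ⟨z.natAbs, fun h => hz ?_⟩
    rcases Int.natAbs_eq z with e | e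
    · rw [e]
      exact le_succ (by simpa using h)
    · rw [e]
      push_cast
      exact neg_mem (by simpa using h)
  obtain ⟨r, hr⟩ := hZ
  obtain ⟨A, hA, f, hfA, hfG, hf⟩ := exists_finer_of_int_bounded ha0 haT hr hst
  obtain ⟨u, hu, g, hg, hgG⟩ := exists_weaklyCompatible_of_finer hA hfA hfG hf
  by_cases hnu : (n : K) ∈ u.nonunits
  · exact .inr ⟨u, hu.trans hOv, hnu, g, hg⟩
  · have := hmin u hu (hg.compatible hnu hn)
    exact absurd (this ▸ hg.1) hgG

end WeakCompatibility

/-! ### Power subgroups and roots in the residue field. -/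

section PowerSubgroups

open Subgroup ValuationSubring

variable {K : Type u} [Field K]

/-- A subgroup of finite index containing all `n`-th powers is definable if the subgroup of `n`-th
powers has finite index. -/
theorem fieldDefinable_of_powers_le {n : ℕ} {T : Subgroup Kˣ}
    (hfin : (powMonoidHom n : Kˣ →* Kˣ).range.FiniteIndex)
    (hT : (powMonoidHom n : Kˣ →* Kˣ).range ≤ T) : FieldDefinable T.fieldSet := by
  set H := (powMonoidHom n : Kˣ →* Kˣ).range
  have hF : Finite (Kˣ ⧸ H) := Subgroup.finite_quotient_of_finiteIndex
  have h : FieldDefinable (⋃ g ∈ {g : Kˣ ⧸ H | g.out ∈ T}, {x : K | ∃ y, y ≠ 0 ∧ x = g.out * y ^ n}) := by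
    refine FieldDefinable.biUnion (Set.toFinite _) fun g _ => ?_
    refine DefinablePred.fieldDefinable (P := fun x : K => ∃ y, y ≠ 0 ∧ x = g.out * y ^ n)
      (DefinablePred.ex ?_)
    open DefinableOp in
    exact ((var (Sum.inr ())).eq (const 0)).not.and
      ((var (Sum.inl 0)).eq ((const _).mul ((var (Sum.inr ())).pow n)))
  convert h using 1
  ext x
  simp only [Set.mem_iUnion, Set.mem_ofPred_eq, exists_prop]
  constructor
  · rintro ⟨t, ht, rfl⟩
    obtain ⟨⟨_, y, rfl⟩, hy⟩ := QuotientGroup.mk_out_eq_mul H t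
    refine ⟨(t : Kˣ ⧸ H), ?_, (y⁻¹ : Kˣ), Units.ne_zero _, ?_⟩
    · rw [hy]
      exact T.mul_mem ht (hT ⟨y, rfl⟩)
    · rw [hy]
      simp
  · rintro ⟨g, hg, y, hy, rfl⟩
    exact ⟨g.out * Units.mk0 y hy ^ n, T.mul_mem hg (hT ⟨Units.mk0 y hy, rfl⟩), by simp⟩

/-- The subgroup generated by the `n`-th powers and the principal units. -/
def ValuationSubring.powSubgroup (A : ValuationSubring K) (n : ℕ) : Subgroup Kˣ :=
  (powMonoidHom n : Kˣ →* Kˣ).range ⊔ A.principalUnitGroup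

namespace ValuationSubring

variable {A : ValuationSubring K} {n : ℕ}

theorem compatible_powSubgroup : A.Compatible (A.powSubgroup n) := by
  intro x hx
  have h0 : 1 + x ≠ 0 := fun h => one_add_notMem_nonunits hx (h ▸ A.nonunits.zero_mem)
  refine ⟨Units.mk0 _ h0, (le_sup_right : A.principalUnitGroup ≤ A.powSubgroup n) ?_, rfl⟩
  rw [mem_principalUnitGroup_iff]
  simpa [mem_nonunits_iff] using hx

theorem pow_mem_powSubgroup (x : K) (hx : x ≠ 0) : x ^ n ∈ (A.powSubgroup n).fieldSet :=
  ⟨Units.mk0 x hx ^ n, (le_sup_left : _ ≤ A.powSubgroup n) ⟨Units.mk0 x hx, rfl⟩, by simp⟩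

theorem neg_one_mem_powSubgroup (hn : n.Prime) (hi : ∃ i : K, i ^ 2 = -1) :
    (-1 : K) ∈ (A.powSubgroup n).fieldSet := by
  rcases hn.eq_two_or_odd' with rfl | hodd
  · obtain ⟨i, hi⟩ := hi
    rw [← hi]
    refine pow_mem_powSubgroup i fun h => ?_
    simp [h] at hi
  · rw [← hodd.neg_one_pow]
    exact pow_mem_powSubgroup _ (by simp)

theorem mem_of_pow_mem {x : K} (hn : n ≠ 0) (hx : x ^ n ∈ A) : x ∈ A := by
  by_contra h
  have h1 := inv_mem_nonunits_of_notMem h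
  have hx0 : x ≠ 0 := fun h' => h (h' ▸ A.zero_mem)
  refine inv_notMem_nonunits hx (pow_ne_zero n hx0) ?_
  rw [← inv_pow]
  obtain ⟨m, rfl⟩ := Nat.exists_eq_succ_of_ne_zero hn
  rw [pow_succ]
  exact mul_mem_nonunits (pow_mem (mem_of_mem_nonunits h1) m) h1

theorem residue_eq_zero_iff_mem_nonunits (x : A) :
    IsLocalRing.residue A x = 0 ↔ (x : K) ∈ A.nonunits := by
  rw [IsLocalRing.residue_eq_zero_iff, coe_mem_nonunits_iff]

/-- A unit x = yⁿu with u a principal unit forces y ∈ `A`, as `A` is integrally closed; then y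
reduces to an n-th root of the residue of x. -/
theorem surjective_pow_of_powSubgroup_eq_top (hn : n ≠ 0) (h : A.powSubgroup n = ⊤) :
    Function.Surjective (fun x : IsLocalRing.ResidueField A => x ^ n) := by
  intro z
  obtain ⟨x, rfl⟩ := IsLocalRing.residue_surjective z
  by_cases hx : (x : K) ∈ A.nonunits
  · exact ⟨0, by simp [hn, ((residue_eq_zero_iff_mem_nonunits x).mpr hx)]⟩
  have hx0 : (x : K) ≠ 0 := fun h => hx (h ▸ A.nonunits.zero_mem)
  have hT : Units.mk0 (x : K) hx0 ∈ A.powSubgroup n := h ▸ Subgroup.mem_top _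
  obtain ⟨_, ⟨y, rfl⟩, u, hu, e⟩ := Subgroup.mem_sup.mp hT
  rw [mem_principalUnitGroup_iff, ← mem_nonunits_iff] at hu
  have e' : (y : K) ^ n * u = x := by
    have := congrArg Units.val e
    simpa using this
  have hu1 : (u : K) ∈ A := by
    have := A.add_mem _ _ (mem_of_mem_nonunits hu) A.one_mem
    rwa [sub_add_cancel] at this
  have hu2 : (u : K) ∉ A.nonunits := by
    have := one_add_notMem_nonunits hu
    rwa [add_sub_cancel] at this
  have hy : (y : K) ∈ A := by
    refine mem_of_pow_mem hn ?_
    rw [← mul_inv_cancel_right₀ u.ne_zero ((y : K) ^ n), e']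
    exact A.mul_mem _ _ x.2 (inv_mem_of_notMem_nonunits hu2)
  refine ⟨IsLocalRing.residue A ⟨y, hy⟩, ?_⟩
  change _ ^ n = _
  rw [← map_pow, ← sub_eq_zero, ← map_sub, residue_eq_zero_iff_mem_nonunits]
  have : (((⟨y, hy⟩ : A) ^ n - x : A) : K) = -(y : K) ^ n * (u - 1) := by
    push_cast
    rw [← e']
    ring
  rw [this]
  exact mul_mem_nonunits (A.neg_mem _ (pow_mem hy n)) hu

theorem natCast_notMem_nonunits {p q : ℕ} (hpq : p.Coprime q) (hp : (p : K) ∈ A.nonunits) :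
    (q : K) ∉ A.nonunits := fun hq => by
  have h1 := mul_mem_nonunits (intCast_mem A (p.gcdA q)) hp
  have h2 := mul_mem_nonunits (intCast_mem A (p.gcdB q)) hq
  have h3 := A.nonunits.add_mem h1 h2
  have h4 : ((p.gcdA q : ℤ) : K) * p + (p.gcdB q : ℤ) * q = 1 := by
    have := Nat.gcd_eq_gcd_ab p q
    rw [hpq] at this
    have := congrArg (Int.cast : ℤ → K) this
    push_cast at this
    rw [this]
    ring
  rw [h4] at h3
  exact one_notMem_nonunits h3

/-- If the powers of exponent `p` have finite index in `Kˣ`, then the residue fields of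
characteristic `p` are perfect. -/
theorem surjective_pow_char {p : ℕ} [hp : Fact p.Prime] [CharP (IsLocalRing.ResidueField A) p]
    (hfin : (powMonoidHom p : Kˣ →* Kˣ).range.FiniteIndex) :
    Function.Surjective (fun x : IsLocalRing.ResidueField A => x ^ p) := by
  set k := IsLocalRing.ResidueField A
  have hinj : Function.Injective (fun x : k => x ^ p) := frobenius_inj k p
  rcases finite_or_infinite k with hk | hk
  · exact Finite.injective_iff_surjective.mp hinj
  by_contra hns
  unfold Function.Surjective at hns
  push Not at hns
  obtain ⟨b, hb⟩ := hns
  have hp0 : p ≠ 0 := hp.out.ne_zero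
  obtain ⟨b', rfl⟩ := IsLocalRing.residue_surjective b
  choose l hl using IsLocalRing.residue_surjective (R := A)
  have hne : ∀ s : k, ((l s ^ p + b' : A) : K) ∉ A.nonunits := by
    intro s hs
    rw [← residue_eq_zero_iff_mem_nonunits, map_add, map_pow, hl] at hs
    refine hb (-s) ?_
    change (-s) ^ p = _
    rw [eq_comm, ← sub_eq_zero]
    rcases hp.out.eq_two_or_odd' with rfl | hodd
    · rw [neg_sq, ← hs]
      have : (2 : k) = 0 := CharP.cast_eq_zero k 2
      linear_combination (-s ^ 2) * this
    · rw [hodd.neg_pow, ← hs]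
      ring
  have hne0 : ∀ s : k, ((l s ^ p + b' : A) : K) ≠ 0 := fun s h =>
    hne s (by rw [h]; exact A.nonunits.zero_mem)
  have hF : Finite (Kˣ ⧸ (powMonoidHom p : Kˣ →* Kˣ).range) :=
    Subgroup.finite_quotient_of_finiteIndex
  -- There are infinitely many units l(s)^p + b' but finitely many cosets, so two of them differ by
  -- a factor c^p.
  obtain ⟨s, t, hst, he⟩ := Finite.exists_ne_map_eq_of_infinite (fun s : k =>
    (Units.mk0 _ (hne0 s) :
      Kˣ ⧸ (powMonoidHom p : Kˣ →* Kˣ).range))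
  obtain ⟨c, hc⟩ := QuotientGroup.eq.mp he
  have hc' : ((l s ^ p + b' : A) : K) * (c : K) ^ p = (l t ^ p + b' : A) := by
    have := congrArg Units.val (eq_inv_mul_iff_mul_eq.mp hc)
    simpa using this
  have hcA : (c : K) ∈ A := by
    refine mem_of_pow_mem hp0 ?_
    rw [← inv_mul_cancel_left₀ (hne0 s) ((c : K) ^ p), hc']
    exact A.mul_mem _ _ (inv_mem_of_notMem_nonunits (hne s)) (l t ^ p + b' : A).2
  have hres : (s ^ p + IsLocalRing.residue A b') * IsLocalRing.residue A ⟨c, hcA⟩ ^ p =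
      t ^ p + IsLocalRing.residue A b' := by
    have : (l s ^ p + b') * ⟨c, hcA⟩ ^ p = l t ^ p + b' := Subtype.ext (by simpa using hc')
    have := congrArg (IsLocalRing.residue A) this
    simpa only [map_mul, map_add, map_pow, hl] using this
  generalize IsLocalRing.residue A ⟨c, hcA⟩ = d at hres
  generalize IsLocalRing.residue A b' = β at hres hb
  rcases eq_or_ne d 1 with rfl | hd
  · rw [one_pow, mul_one] at hres
    exact hst (hinj (add_right_cancel hres))
  -- Solve (s^p + β) d^p = t^p + β for β; additivity of x ↦ x^p shows the solution to be a p-th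
  -- power.
  · refine hb ((t - s * d) / (d - 1)) ?_
    have hd1 : d ^ p - 1 ≠ 0 := by
      rw [sub_ne_zero]
      intro h
      exact hd (hinj (by simpa using h))
    have e1 : (t - s * d) ^ p = t ^ p - s ^ p * d ^ p := by rw [sub_pow_char, mul_pow]
    have e2 : (d - 1) ^ p = d ^ p - 1 := by rw [sub_pow_char, one_pow]
    rw [div_pow, e1, e2, div_eq_iff hd1]
    linear_combination -hres

end ValuationSubring

theorem surjective_pow_of_prime {k : Type*} [Field k]
    (h : ∀ q : ℕ, q.Prime → Function.Surjective (fun x : k => x ^ q)) {n : ℕ} (hn : 0 < n) :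
    Function.Surjective (fun x : k => x ^ n) := by
  induction n using Nat.recOnMul with
  | zero => exact absurd hn (lt_irrefl 0)
  | one => exact fun x => ⟨x, pow_one x⟩
  | prime p hp => exact h p hp
  | mul a b iha ihb =>
    intro x
    obtain ⟨y, rfl⟩ := ihb (Nat.pos_of_mul_pos_left hn) x
    obtain ⟨z, rfl⟩ := iha (Nat.pos_of_mul_pos_right hn) y
    exact ⟨z, pow_mul z a b⟩

open ValuationSubring

variable [CharZero K] (hi : ∃ i : K, i ^ 2 = -1)
  (hfin : ∀ n : ℕ, 0 < n → (powMonoidHom n : Kˣ →* Kˣ).range.FiniteIndex)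

include hi hfin

/-- In residue characteristic `p`, a compatible proper subgroup generated by principal units and
powers of prime exponent different from `p` yields a definable valuation. -/
theorem hasDefinableValuation_of_residueChar {A O : ValuationSubring K} {p q : ℕ} (hp : p.Prime)
    (hq : q.Prime) (hpq : p ≠ q) (htop : A.powSubgroup q ≠ ⊤) (hO : O ≠ ⊤)
    (hc : O.Compatible (A.powSubgroup q)) (hpO : (p : K) ∈ O.nonunits) :
    HasDefinableValuation K := by
  refine (hasDefinableValuation_or_exists_weaklyCompatible
    (fieldDefinable_of_powers_le (hfin q hq.pos) le_sup_left) htop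
    (neg_one_mem_powSubgroup hq hi) pow_mem_powSubgroup hO hc).resolve_right ?_
  -- A finer ring has a larger maximal ideal, so p and q would both lie in that of u, and hence 1.
  rintro ⟨u, huO, hqu, -⟩
  exact natCast_notMem_nonunits ((Nat.coprime_primes hp hq).mpr hpq)
    (nonunits_le_nonunits.mpr huO hpO) hqu

/-- If the residue field is not closed under roots of two different prime exponents, then there is
a definable valuation. -/
theorem hasDefinableValuation_of_two_primes {A : ValuationSubring K} (hA : A ≠ ⊤) {p q : ℕ}
    (hp : p.Prime) (hq : q.Prime) (hpq : p ≠ q) (hpt : A.powSubgroup p ≠ ⊤)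
    (hqt : A.powSubgroup q ≠ ⊤) : HasDefinableValuation K := by
  have hmem : ∀ x : K, x ∈ (A.powSubgroup p).fieldSet → x ∈ (A.powSubgroup q).fieldSet →
      x ∈ (A.powSubgroup p ⊓ A.powSubgroup q).fieldSet := by
    rintro _ ⟨t, ht, rfl⟩ h
    exact ⟨t, ⟨ht, coe_mem_fieldSet.mp h⟩, rfl⟩
  have hrange : (powMonoidHom (p * q) : Kˣ →* Kˣ).range ≤ A.powSubgroup p ⊓ A.powSubgroup q := by
    rintro _ ⟨y, rfl⟩
    refine ⟨le_sup_left (a := (powMonoidHom p : Kˣ →* Kˣ).range) ⟨y ^ q, ?_⟩,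
      le_sup_left (a := (powMonoidHom q : Kˣ →* Kˣ).range) ⟨y ^ p, ?_⟩⟩
    · simp [← pow_mul, mul_comm]
    · simp [← pow_mul]
  have hpow : ∀ x : K, x ≠ 0 → x ^ (p * q) ∈ (A.powSubgroup p ⊓ A.powSubgroup q).fieldSet :=
    fun x hx => ⟨Units.mk0 x hx ^ (p * q), hrange ⟨Units.mk0 x hx, rfl⟩, by simp⟩
  rcases hasDefinableValuation_or_exists_weaklyCompatible
    (fieldDefinable_of_powers_le (hfin _ (Nat.mul_pos hp.pos hq.pos)) hrange)
    (fun h => hpt (top_le_iff.mp (h ▸ inf_le_left)))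
    (hmem _ (neg_one_mem_powSubgroup hp hi) (neg_one_mem_powSubgroup hq hi)) hpow hA
    (fun x hx => hmem _ (compatible_powSubgroup x hx) (compatible_powSubgroup x hx)) with h | h
  · exact h
  obtain ⟨u, huA, hu, f, hf⟩ := h
  have hutop : u ≠ ⊤ := fun h => hA (top_le_iff.mp (h ▸ huA))
  -- Whichever prime lies in 𝔪_u, the other is a unit of u, so Newton approximation upgrades weak
  -- compatibility with its own power subgroup.
  by_cases hpu : (p : K) ∈ u.nonunits
  · refine hasDefinableValuation_of_residueChar hi hfin hp hq hpq hqt hutop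
      ((hf.mono inf_le_right).compatible ?_ pow_mem_powSubgroup) hpu
    exact natCast_notMem_nonunits ((Nat.coprime_primes hp hq).mpr hpq) hpu
  · have hqu : (q : K) ∈ u.nonunits := by
      have := mul_mem_nonunits (inv_mem_of_notMem_nonunits hpu) hu
      rwa [Nat.cast_mul, inv_mul_cancel_left₀ (by exact_mod_cast hp.ne_zero)] at this
    exact hasDefinableValuation_of_residueChar hi hfin hq hp hpq.symm hpt hutop
      ((hf.mono inf_le_left).compatible hpu pow_mem_powSubgroup) hqu

theorem surjective_pow_of_ringChar_pos (hno : ¬ HasDefinableValuation K) {A : ValuationSubring K}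
    (hA : A ≠ ⊤) (hchar : 0 < ringChar (IsLocalRing.ResidueField A)) {n : ℕ} (hn : 0 < n) :
    Function.Surjective (fun x : IsLocalRing.ResidueField A => x ^ n) := by
  refine surjective_pow_of_prime (fun q hq => ?_) hn
  set p := ringChar (IsLocalRing.ResidueField A) with hpdef
  have hpp : p.Prime := (CharP.char_is_prime_or_zero (IsLocalRing.ResidueField A) p).resolve_right
    hchar.ne'
  have : Fact p.Prime := ⟨hpp⟩
  rcases eq_or_ne p q with rfl | hpq
  · exact surjective_pow_char (hfin _ hq.pos)
  by_contra hns
  refine hno (hasDefinableValuation_of_residueChar hi hfin hpp hq hpq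
    (fun h => hns (surjective_pow_of_powSubgroup_eq_top hq.ne_zero h)) hA
    compatible_powSubgroup ?_)
  have h := (residue_eq_zero_iff_mem_nonunits (p : A)).mp (by
    rw [map_natCast]; exact CharP.cast_eq_zero _ p)
  simpa using h

end PowerSubgroups

theorem mainTheorem5 (K : Type u) [Field K] [CharZero K] (hA : AssumptionA K)
    (hi : ∃ i : K, i ^ 2 = -1) :
    (∃ (Γ₀ : Type u) (_ : LinearOrderedCommGroupWithZero Γ₀) (v : Valuation K Γ₀),
      Function.Surjective v ∧ v.IsNontrivial ∧ v.IsDefinable) ∨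
    (∀ (Γ₀ : Type w) [LinearOrderedCommGroupWithZero Γ₀] (v : Valuation K Γ₀), v.IsNontrivial →
      (0 < ringChar v.residue →
        ∀ n : ℕ, 0 < n → Function.Surjective (fun x : v.residue => x ^ n)) ∧
      (ringChar v.residue = 0 →
        ∃ p : ℕ, p.Prime ∧ ∀ n : ℕ, n.Prime → n ≠ p →
          Function.Surjective (fun x : v.residue => x ^ n))) := by
  have hfin := (hA K).1
  by_cases hno : HasDefinableValuation K
  · exact .inl hno.exists_valuation
  refine .inr fun Γ₀ _ v hv => ?_
  have hvA : v.valuationSubring ≠ ⊤ := fun h => v.valuationSubring_eq_top_iff.mp h hv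
  refine ⟨fun hchar n hn => surjective_pow_of_ringChar_pos hi hfin hno hvA hchar hn, fun _ => ?_⟩
  have key : ∀ q : ℕ, q.Prime → ¬ Function.Surjective (fun x : v.residue => x ^ q) →
      v.valuationSubring.powSubgroup q ≠ ⊤ := fun q hq hns h =>
    hns (ValuationSubring.surjective_pow_of_powSubgroup_eq_top hq.ne_zero h)
  by_contra! hcon
  obtain ⟨p, hp, -, hpn⟩ := hcon 2 Nat.prime_two
  obtain ⟨q, hq, hqp, hqn⟩ := hcon p hp
  exact hno (hasDefinableValuation_of_two_primes hi hfin hvA hq hp hqp (key q hq hqn)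
    (key p hp hpn))
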